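/- Let $d\ge 1$ and $\gamma>0$. For $y\in\mathbb Z^d$ write $|y|=\sum_i|y_i|$; sites $x,y$ are adjacent ($x\sim y$) if $|x-y|=1$. **Heights.** Let $\Lambda\subset\mathbb Z^d$ be finite. Let $\Delta_{xx}=2d+\gamma$, $\Delta_{xy}=-1$ if $x\sim y$, and $\Delta_{xy}=0$ otherwise ($x,y\in\Lambda$). A legal toppling of $\eta\in[0,\infty)^\Lambda$ at $x$ with $\eta_x\ge 2d+\gamma$ replaces $\eta$ by $(\eta_y-\Delta_{xy})_{y\in\Lambda}$. A stable configuration $\eta\in[0,2d+\gamma)^\Lambda$ is recurrent if from every $\zeta\in[0,\infty)^\Lambda$ it can be reached by adding some $h\in[0,\infty)^\Lambda$ and then performing finitely many legal topplings. Let $m^{(\gamma)}_\Lambda$ be normalized Lebesgue measure on the set of recurrent configurations, and let $\nu^{(\gamma)}_\Lambda$ be its image on $\{0,\dots,2d\}^\Lambda$ under the map replacing each height $\eta_x$ by $\min(\lfloor\eta_x\rfloor,2d)$. **Trees.** Let $G$ be the graph with vertex set $\mathbb Z^d\cup\{\varpi\}$ whose edges are the nearest-neighbour (ordinary) edges of $\mathbb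 Z^d$ and one (dissipative) edge between $x$ and $\varpi$ for each $x\in\mathbb Z^d$. Let $G_\Lambda$ be the multigraph obtained from $G$ by identifying all sites of $\mathbb Z^d\setminus\Lambda$ with $\varpi$ and removing loops (parallel edges are kept). Let $\mu^{(\gamma)}_\Lambda$ be the probability measure on spanning trees $t$ of $G_\Lambda$ with $\mu^{(\gamma)}_\Lambda(t)$ proportional to $\gamma^{H(t)}$, where $H(t)$ is the number of dissipative edges of $t$; view it as a measure on $\{0,1\}^{E(G)}$, giving edges outside $G_\Lambda$ the value $0$. **The map $\varphi$.** For each non-empty $P\subset\{y:|y|=1\}$ and each $K=\{k,\dots,k+|P|-1\}\subset\{0,\dots,2d-1\}$ fix an arbitrary bijection $\alpha_{P,K}:P\to K$. Let $\omega\in\{0,1\}^{E(G)}$ be a spanning tree of $G$, with graph distance $d_\omega$, and let $\pi_x$ be the self-avoiding path in $\omega$ from $x$ to $\varpi$. Put $$n_x=|\{y:|y|=1,\ d_\omega(x+y,\varpi)<d_\omega(x,\varpi)\}|,\qquad P_x=\{y:|y|=1,\ d_\omega(x+y,\varpi)=d_\omega(x,\varpi)-1\},$$ $$K_x=\{2d-n_x,\dots,2d-n_x+|P_x|-1\}.$$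 Define $\varphi(\omega)\in\{0,\dots,2d\}^{\mathbb Z^d}$ by $\varphi(\omega)_x=2d$ if the first edge of $\pi_x$ is the dissipative edge at $x$, and $\varphi(\omega)_x=\alpha_{P_x,K_x}(y_x)$ if the first edge of $\pi_x$ is the edge between $x$ and $x+y_x$. **Statement.** As $\Lambda\uparrow\mathbb Z^d$ through the finite subsets of $\mathbb Z^d$ directed by inclusion (so along every exhausting sequence): (a) $\mu^{(\gamma)}_\Lambda$ converges weakly to a probability measure $\mu^{(\gamma)}$ on $\{0,1\}^{E(G)}$, and $\mu^{(\gamma)}$-almost every $\omega$ is a spanning tree of $G$, so that $\varphi$ is defined $\mu^{(\gamma)}$-a.e.; (b) $\nu^{(\gamma)}_\Lambda$ (with heights extended by $0$ off $\Lambda$) converges weakly to a probability measure $\nu^{(\gamma)}$ on $\{0,\dots,2d\}^{\mathbb Z^d}$; (c) for every choice of the bijections $\alpha_{P,K}$, the map $\varphi$ is $\mu^{(\gamma)}$-a.e. measurable and the image of $\mu^{(\gamma)}$ under $\varphi$ is $\nu^{(\gamma)}$. -/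

import Mathlib

open MeasureTheory Filter Topology

noncomputable section

namespace DissipativeSandpile

/-- Sites of the lattice `ℤ^d`. -/
abbrev Site (d : ℕ) : Type := Fin d → ℤ

/-- The `ℓ¹` length of a lattice vector; nearest neighbours are at distance one. -/
def len {d : ℕ} (y : Site d) : ℤ := ∑ i, |y i|

/-! ### The continuous-height model in a finite volume -/

/-- The dissipative toppling matrix on `Λ`. -/
def topplingMatrix (d : ℕ) (γ : ℝ) (Λ : Finset (Site d)) : Matrix Λ Λ ℝ :=
  fun x y => if x = y then 2 * d + γ else if len (x.1 - y.1) = 1 then -1 else 0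

/-- `η'` arises from `η` by one legal toppling. -/
def LegalToppling (d : ℕ) (γ : ℝ) (Λ : Finset (Site d)) (η η' : Λ → ℝ) : Prop :=
  ∃ x : Λ, 2 * d + γ ≤ η x ∧ η' = fun y => η y - topplingMatrix d γ Λ x y

/-- Stable configurations, `[0, 2d + γ)^Λ`. -/
def stableConfigs (d : ℕ) (γ : ℝ) (Λ : Finset (Site d)) : Set (Λ → ℝ) :=
  {η | ∀ x, 0 ≤ η x ∧ η x < 2 * d + γ}

/-- Recurrent configurations: stable configurations that can be reached from every
non-negative configuration by adding non-negative heights and then stabilizing through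
finitely many legal topplings. -/
def recurrentConfigs (d : ℕ) (γ : ℝ) (Λ : Finset (Site d)) : Set (Λ → ℝ) :=
  {η | η ∈ stableConfigs d γ Λ ∧ ∀ ζ : Λ → ℝ, 0 ≤ ζ →
    ∃ h : Λ → ℝ, 0 ≤ h ∧ Relation.ReflTransGen (LegalToppling d γ Λ) (ζ + h) η}

/-- Normalized Lebesgue measure on the recurrent configurations. -/
def mMeasure (d : ℕ) (γ : ℝ) (Λ : Finset (Site d)) : Measure (Λ → ℝ) :=
  ProbabilityTheory.cond volume (recurrentConfigs d γ Λ)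

/-- Discretization of one height: `h` if `h ≤ r < h + 1` with `h < 2d`, and `2d` if `r ≥ 2d`. -/
def discretize (d : ℕ) (r : ℝ) : Fin (2 * d + 1) :=
  ⟨min ⌊r⌋₊ (2 * d), by omega⟩

/-- Discrete height configurations on `ℤ^d`, with values in `{0, …, 2d}`. -/
abbrev Heights (d : ℕ) : Type := Site d → Fin (2 * d + 1)

/-- A configuration on `Λ` viewed on `ℤ^d`, with value `0` off `Λ`; for weak convergence the
values off `Λ` are immaterial as `Λ` exhausts `ℤ^d`. -/
def extendZero (d : ℕ) (Λ : Finset (Site d)) (ξ : Λ → Fin (2 * d + 1)) : Heights d :=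
  fun x => if h : x ∈ Λ then ξ ⟨x, h⟩ else 0

/-- The discretized measure on `Λ`: image of the stationary measure under the discretization. -/
def nuMeasure (d : ℕ) (γ : ℝ) (Λ : Finset (Site d)) : Measure (Heights d) :=
  ((mMeasure d γ Λ).map (fun η x => discretize d (η x))).map (extendZero d Λ)

/-! ### The graph with a dissipative vertex and its weighted spanning trees -/

/-- The graph on `ℤ^d ∪ {ϖ}`, with `ϖ = none`: nearest-neighbour (ordinary) edges, and a
dissipative edge from every site to `ϖ`. -/
def G (d : ℕ) : SimpleGraph (Option (Site d)) where
  Adj u v := match u, v with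
    | some x, some y => len (x - y) = 1
    | some _, none => True
    | none, some _ => True
    | none, none => False
  symm := ⟨by
    rintro (_ | x) (_ | y) h
    · exact h
    · trivial
    · trivial
    · have e : len (y - x) = len (x - y) := by
        unfold len
        exact Finset.sum_congr rfl fun i _ => abs_sub_comm (y i) (x i)
      exact e.trans h⟩
  loopless := ⟨by
    rintro (_ | x) h
    · exact h
    · simp [len] at h⟩

/-- Edges of the infinite graph. -/
abbrev Edge (d : ℕ) : Type := (G d).edgeSet

/-- Edge configurations `{0,1}^E`. -/
abbrev EdgeConfig (d : ℕ) : Type := Edge d → Bool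

/-- The spanning subgraph of open edges. -/
def openGraph {d : ℕ} (ω : EdgeConfig d) : SimpleGraph (Option (Site d)) :=
  SimpleGraph.fromEdgeSet {e | ∃ h : e ∈ (G d).edgeSet, ω ⟨e, h⟩ = true}

/-- Identification of all sites outside `Λ` with `ϖ`. -/
def collapse {d : ℕ} (Λ : Finset (Site d)) : Option (Site d) → Option Λ
  | none => none
  | some x => if h : x ∈ Λ then some ⟨x, h⟩ else none

/-- The ends in `Λ ∪ {ϖ}` of an edge after the identification. -/
def ends {d : ℕ} (Λ : Finset (Site d)) (e : Edge d) : Sym2 (Option Λ) :=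
  Sym2.map (collapse Λ) e.1

/-- Spanning trees of the finite multigraph obtained by the identification: no loops, no two
parallel edges, and the resulting simple graph on `Λ ∪ {ϖ}` is a tree. -/
def spanningTrees (d : ℕ) (Λ : Finset (Site d)) : Set (EdgeConfig d) :=
  {t | (∀ e, t e = true → ¬ (ends Λ e).IsDiag) ∧
    Set.InjOn (ends Λ) {e | t e = true} ∧
    (SimpleGraph.fromEdgeSet (ends Λ '' {e | t e = true})).IsTree}

/-- Number of dissipative edges of `t`. -/
def numDiss {d : ℕ} (t : EdgeConfig d) : ℕ :=
  {e : Edge d | t e = true ∧ none ∈ e.1}.ncard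

/-- The unnormalized weighted spanning-tree measure, of weight `γ ^ numDiss t` at `t`. -/
def treeWeight (d : ℕ) (γ : ℝ) (Λ : Finset (Site d)) : Measure (EdgeConfig d) :=
  Measure.sum fun t : spanningTrees d Λ => ENNReal.ofReal (γ ^ numDiss t.1) • Measure.dirac t.1

/-- The weighted spanning-tree probability measure on `Λ`. -/
def muMeasure (d : ℕ) (γ : ℝ) (Λ : Finset (Site d)) : Measure (EdgeConfig d) :=
  (treeWeight d γ Λ Set.univ)⁻¹ • treeWeight d γ Λ

/-! ### The map from trees to heights -/

/-- `α P K` is a bijection from `P` to `K`, for all non-empty `P ⊆ {y : |y| = 1}` and all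
intervals `K = {k, …, k + |P| - 1} ⊆ {0, …, 2d - 1}`. -/
def IsLabelling (d : ℕ) (α : Set (Site d) → Set ℕ → Site d → ℕ) : Prop :=
  ∀ (P : Set (Site d)) (k : ℕ), P.Nonempty → P ⊆ {y | len y = 1} → k + P.ncard ≤ 2 * d →
    Set.BijOn (α P (Set.Ico k (k + P.ncard))) P (Set.Ico k (k + P.ncard))

/-- Graph distance to `ϖ` in `ω`. -/
def distToRoot {d : ℕ} (ω : EdgeConfig d) (x : Site d) : ℕ :=
  (openGraph ω).dist (some x) none

/-- The number of neighbours of `x` that are closer to `ϖ`. -/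
def nData {d : ℕ} (ω : EdgeConfig d) (x : Site d) : ℕ :=
  {y : Site d | len y = 1 ∧ distToRoot ω (x + y) < distToRoot ω x}.ncard

/-- The directions of the neighbours of `x` that are closer to `ϖ` by exactly one. -/
def PData {d : ℕ} (ω : EdgeConfig d) (x : Site d) : Set (Site d) :=
  {y | len y = 1 ∧ distToRoot ω (x + y) + 1 = distToRoot ω x}

/-- The set `{2d - n, …, 2d - n + |P| - 1}`. -/
def KData {d : ℕ} (ω : EdgeConfig d) (x : Site d) : Set ℕ :=
  Set.Ico (2 * d - nData ω x) (2 * d - nData ω x + (PData ω x).ncard)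

/-- The unique self-avoiding path from `x` to `ϖ` in the tree `ω`. -/
def rootPath {d : ℕ} (ω : EdgeConfig d) (hω : (openGraph ω).IsTree) (x : Site d) :
    (openGraph ω).Walk (some x) none :=
  (hω.existsUnique_path (some x) none).choose

open Classical in
/-- The map from trees to heights. The height at `x` is `2d` if the path from `x` to `ϖ` starts
with the dissipative edge at `x`, and `α P K y` if it starts with the edge from `x` to `x + y`
(a number below `2d`, so that the minimum has no effect). Configurations that are not trees get
the value `0`. -/
def phi (d : ℕ) (α : Set (Site d) → Set ℕ → Site d → ℕ) (ω : EdgeConfig d) : Heights d :=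
  fun x =>
    if hω : (openGraph ω).IsTree then
      match (rootPath ω hω x).snd with
      | none => Fin.last (2 * d)
      | some z => ⟨min (α (PData ω x) (KData ω x) (z - x)) (2 * d), by omega⟩
    else 0

/-! ### Weak convergence -/

/-- Weak convergence of probability measures (all members and the limit are probability
measures, and convergence is in Mathlib's topology of weak convergence). -/
def WeaklyConverges {ι Ω : Type*} [MeasurableSpace Ω] [TopologicalSpace Ω]
    [OpensMeasurableSpace Ω] (l : Filter ι) (P : ι → Measure Ω) (Q : Measure Ω) : Prop :=
  ∃ (hP : ∀ i, IsProbabilityMeasure (P i)) (hQ : IsProbabilityMeasure Q),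
    Tendsto (β := ProbabilityMeasure Ω) (fun i => ⟨P i, hP i⟩) l
      (@nhds (ProbabilityMeasure Ω) _ ⟨Q, hQ⟩)

/-- The edge set is countable, so that the product σ-algebra on edge configurations is the
Borel one. -/
instance (d : ℕ) : Countable (Edge d) := by
  unfold Edge
  have : Countable (Sym2 (Option (Site d))) := by
    unfold Sym2
    infer_instance
  infer_instance

end DissipativeSandpile

end

/-!
Spanning trees of the wired graph on `Λ` are the same as *rooted arrow fields*: every site of `Λ`
points to one of its `2d` neighbours (weight `1`) or to `ϖ` (weight `γ`), and all paths along the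
arrows leave `Λ`. In this encoding the tree measure and the sandpile measure are both images of one
probability measure on arrow fields, and both limits follow from the limit of that measure.

*Convergence of the arrow fields.* Expanding the determinant of a Laplacian row by row gives the
matrix-tree theorem `det_arrowLaplacian`. Hence the probability that the arrows on a finite set `S`
have prescribed values is a determinant of size `|S|` in the values of Green's function near `S`
(`fieldMeasure_cylinder`). Green's function increases with `Λ` and is at most `1 / γ`, by the
minimum principle, so that all cylinder probabilities converge. The space of probability measures
on a compact space is compact, hence there is a limit measure.

*Paths are short.* Redirecting the arrow at the `N`-th site of a path to `ϖ` never creates a cycle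
and multiplies the weight by `γ`, and at most `2d` fields lead to the same one. Hence the path from
a given site has more than `N` steps with probability at most `(2d / (2d + γ)) ^ N`, uniformly in
`Λ` (`fieldMeasure_longPath_le`). In the limit every path reaches `ϖ`, which means that the limiting
edge configuration is a tree.

*Sandpiles.* A stable configuration is recurrent if and only if it has no forbidden
subconfiguration (`mem_recurrentConfigs_iff`), a property of the discretized heights. The burning
algorithm then gives, for every labelling, a bijection between rooted fields and discretized
recurrent configurations, under which the depth of a site is its burning time; the volume of the
cell of a discretized configuration is the weight of its field (`map_restrict_recurrentConfigs`).

*The limit of the heights.* The height at a site depends on the paths from that site and its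
neighbours only. As these are short, the heights in `Λ` are with high probability given by the same
local rule as in infinite volume, and this rule is almost everywhere continuous for the limit
measure; this is the criterion `weaklyConverges_map`. The infinite-volume rule is `φ` of the tree
(`phi_treeOf`), and it is measurable as a function of the tree by the Lusin-Souslin theorem, since
a rooted field is determined by its tree.
-/

noncomputable section

namespace DissipativeSandpile

/-! ### Rooted maps and their trees -/

section RootedMaps

variable {V : Type*}

/-- One step along the arrows of `f`, where `none` is an absorbing root. -/
def step (f : V → Option V) (u : Option V) : Option V := u.bind f

/-- All orbits of `f` end in the root `none`; equivalently, `f` has neither cycles nor infinite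
orbits. -/
def Rooted (f : V → Option V) : Prop := ∀ u, ∃ n, (step f)^[n] u = none

/-- The number of steps from `u` to the root (the junk value `0` if the orbit is infinite). -/
def depth (f : V → Option V) (u : Option V) : ℕ := sInf {n | (step f)^[n] u = none}

/-- The graph that joins every vertex to its image under `f`. -/
def parentGraph (f : V → Option V) : SimpleGraph (Option V) :=
  SimpleGraph.fromEdgeSet (Set.range fun x => s(some x, f x))

@[simp] lemma step_none (f : V → Option V) : step f none = none := rfl

@[simp] lemma step_some (f : V → Option V) (x : V) : step f (some x) = f x := rfl

@[simp] lemma iterate_step_none (f : V → Option V) (n : ℕ) : (step f)^[n] none = none :=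
  Function.iterate_fixed rfl n

lemma iterate_step_eq_none_of_le {f : V → Option V} {m n : ℕ} {u : Option V} (h : m ≤ n)
    (hm : (step f)^[m] u = none) : (step f)^[n] u = none := by
  obtain ⟨k, rfl⟩ := Nat.exists_eq_add_of_le' h
  rw [Function.iterate_add_apply, hm, iterate_step_none]

lemma depth_eq_iff {f : V → Option V} {u : Option V} (h : ∃ n, (step f)^[n] u = none) (k : ℕ) :
    depth f u = k ↔ (step f)^[k] u = none ∧ ∀ j < k, (step f)^[j] u ≠ none := by
  constructor
  · rintro rfl
    exact ⟨Nat.sInf_mem h, fun j hj => Nat.notMem_of_lt_sInf hj⟩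
  · rintro ⟨h1, h2⟩
    refine le_antisymm (Nat.sInf_le h1) ?_
    by_contra! hlt
    exact h2 _ hlt (Nat.sInf_mem h)

@[simp] lemma depth_none (f : V → Option V) : depth f none = 0 :=
  Nat.sInf_eq_zero.2 (Or.inl rfl)

lemma depth_some {f : V → Option V} (hf : Rooted f) (x : V) :
    depth f (some x) = depth f (f x) + 1 := by
  obtain ⟨h1, h2⟩ := (depth_eq_iff (hf (f x)) _).1 rfl
  refine (depth_eq_iff (hf _) _).2 ⟨by rwa [Function.iterate_succ_apply], ?_⟩
  rintro (_ | j) hj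
  · simp
  · rw [Function.iterate_succ_apply]
    exact h2 j (by omega)

/-- A map is rooted as soon as some function counts down along its arrows, and that function is
the depth. -/
lemma rooted_of_depth {f : V → Option V} (D : Option V → ℕ) (h0 : D none = 0)
    (h1 : ∀ x, D (some x) = D (f x) + 1) : Rooted f ∧ depth f = D := by
  have key : ∀ n u, D u = n → (step f)^[n] u = none := by
    intro n
    induction n with
    | zero => rintro (_ | x) hu
              · rfl
              · simp [h1] at hu
    | succ n ih =>
      rintro (_ | x) hu
      · simp
      · rw [Function.iterate_succ_apply]
        exact ih _ (by rw [h1] at hu; simpa using hu)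
  have hr : Rooted f := fun u => ⟨_, key _ u rfl⟩
  refine ⟨hr, ?_⟩
  have key2 : ∀ n u, D u = n → depth f u = n := by
    intro n
    induction n with
    | zero => rintro (_ | x) hu
              · simp
              · simp [h1] at hu
    | succ n ih =>
      rintro (_ | x) hu
      · simp [h0] at hu
      · rw [depth_some hr, ih (f x) (by rw [h1] at hu; simpa using hu)]
  exact funext fun u => key2 _ u rfl

lemma parentGraph_adj {f : V → Option V} (hf : Rooted f) {u v : Option V} :
    (parentGraph f).Adj u v ↔ ∃ x, (u = some x ∧ v = f x) ∨ (v = some x ∧ u = f x) := by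
  have hne : ∀ x, f x ≠ some x := fun x h => by
    have := depth_some hf x
    rw [h] at this
    omega
  simp only [parentGraph, SimpleGraph.fromEdgeSet_adj, Set.mem_range, Sym2.eq_iff]
  constructor
  · rintro ⟨⟨x, h | h⟩, -⟩
    · exact ⟨x, Or.inl ⟨h.1.symm, h.2.symm⟩⟩
    · exact ⟨x, Or.inr ⟨h.1.symm, h.2.symm⟩⟩
  · rintro ⟨x, ⟨rfl, rfl⟩ | ⟨rfl, rfl⟩⟩
    · exact ⟨⟨x, Or.inl ⟨rfl, rfl⟩⟩, (hne x).symm⟩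
    · exact ⟨⟨x, Or.inr ⟨rfl, rfl⟩⟩, hne x⟩

lemma parentGraph_adj_some {f : V → Option V} (hf : Rooted f) (x : V) :
    (parentGraph f).Adj (some x) (f x) :=
  (parentGraph_adj hf).2 ⟨x, Or.inl ⟨rfl, rfl⟩⟩

/-- A neighbour that is not deeper than `u` is the parent of `u`. -/
lemma step_eq_of_parentGraph_adj {f : V → Option V} (hf : Rooted f) {u v : Option V}
    (h : (parentGraph f).Adj u v) (hle : depth f v ≤ depth f u) : v = step f u := by
  obtain ⟨x, ⟨rfl, rfl⟩ | ⟨rfl, rfl⟩⟩ := (parentGraph_adj hf).1 h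
  · rfl
  · rw [depth_some hf] at hle
    omega

lemma exists_path_parentGraph {f : V → Option V} (hf : Rooted f) (u : Option V) :
    ∃ p : (parentGraph f).Walk u none, p.IsPath ∧ p.length = depth f u ∧
      (∀ v ∈ p.support, depth f v ≤ depth f u) ∧ p.snd = step f u := by
  generalize hn : depth f u = n
  induction n generalizing u with
  | zero =>
    rcases u with _ | x
    · exact ⟨SimpleGraph.Walk.nil, by simp⟩
    · simp [depth_some hf] at hn
  | succ n ih =>
    rcases u with _ | x
    · simp at hn
    · rw [depth_some hf] at hn
      obtain ⟨p, hp, hl, hs, -⟩ := ih (f x) (by omega)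
      refine ⟨SimpleGraph.Walk.cons (parentGraph_adj_some hf x) p, ?_, by simp [hl], ?_, by simp⟩
      · refine hp.cons fun hmem => ?_
        have := hs _ hmem
        rw [depth_some hf] at this
        omega
      · intro v hv
        rw [SimpleGraph.Walk.support_cons, List.mem_cons] at hv
        rcases hv with rfl | hv
        · rw [depth_some hf]; omega
        · exact (hs v hv).trans (by omega)

/-- The deepest vertex of a cycle would have its parent as both neighbours in the cycle. -/
theorem parentGraph_isTree {f : V → Option V} (hf : Rooted f) : (parentGraph f).IsTree := by
  classical
  refine ⟨⟨?_⟩, ?_⟩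
  · have h : ∀ u, (parentGraph f).Reachable u none := fun u =>
      (exists_path_parentGraph hf u).choose.reachable
    exact fun u v => (h u).trans (h v).symm
  · intro v c hc
    obtain ⟨u, hu, hmax⟩ := c.support.toFinset.exists_max_image (depth f)
      ⟨v, by simp⟩
    rw [List.mem_toFinset] at hu
    have hc' := hc.rotate hu
    have hmem : ∀ w ∈ (c.rotate u hu).support, depth f w ≤ depth f u := fun w hw =>
      hmax w (by simpa using hw)
    have hnil := hc'.not_nil
    refine hc'.snd_ne_penultimate ?_
    rw [step_eq_of_parentGraph_adj hf ((c.rotate u hu).adj_snd hnil)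
        (hmem _ (List.mem_of_mem_tail (SimpleGraph.Walk.snd_mem_tail_support hnil))),
      step_eq_of_parentGraph_adj hf ((c.rotate u hu).adj_penultimate hnil).symm
        (hmem _ (List.mem_of_mem_dropLast
          (SimpleGraph.Walk.penultimate_mem_dropLast_support hnil)))]

lemma depth_le_length {f : V → Option V} (hf : Rooted f) {u v : Option V}
    (p : (parentGraph f).Walk u v) : depth f u ≤ p.length + depth f v := by
  induction p with
  | nil => simp
  | cons h p ih =>
    rw [SimpleGraph.Walk.length_cons]
    obtain ⟨x, ⟨rfl, rfl⟩ | ⟨rfl, rfl⟩⟩ := (parentGraph_adj hf).1 h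
    · rw [depth_some hf]; omega
    · rw [depth_some hf] at ih; omega

lemma parentGraph_dist {f : V → Option V} (hf : Rooted f) (u : Option V) :
    (parentGraph f).dist u none = depth f u := by
  obtain ⟨p, -, hl, -⟩ := exists_path_parentGraph hf u
  refine le_antisymm (hl ▸ SimpleGraph.dist_le p) ?_
  obtain ⟨q, hq⟩ := (parentGraph_isTree hf).connected.exists_walk_length_eq_dist u none
  simpa [hq] using depth_le_length hf q

lemma parentGraph_path_snd {f : V → Option V} (hf : Rooted f) {u : Option V}
    {p : (parentGraph f).Walk u none} (hp : p.IsPath) : p.snd = step f u := by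
  obtain ⟨q, hq, -, -, hs⟩ := exists_path_parentGraph hf u
  rw [((parentGraph_isTree hf).existsUnique_path u none).unique hp hq, hs]

/-- A tree is the parent graph of the map that sends each vertex to a neighbour that is closer to
the root. -/
lemma eq_parentGraph_of_isTree {K : SimpleGraph (Option V)} (hK : K.IsTree) {f : V → Option V}
    (hadj : ∀ x, K.Adj (some x) (f x))
    (hdist : ∀ x, K.dist (some x) none = K.dist (f x) none + 1) :
    Rooted f ∧ K = parentGraph f := by
  have hf : Rooted f := (rooted_of_depth (fun u => K.dist u none) (by simp) hdist).1
  refine ⟨hf, ?_⟩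
  have hle : parentGraph f ≤ K := by
    intro u v h
    obtain ⟨x, ⟨rfl, rfl⟩ | ⟨rfl, rfl⟩⟩ := (parentGraph_adj hf).1 h
    · exact hadj x
    · exact (hadj x).symm
  have := (SimpleGraph.isTree_iff_maximal_isAcyclic.1 (parentGraph_isTree hf)).2
  exact (this.le_of_ge hK.isAcyclic hle).antisymm hle

end RootedMaps

/-! ### The matrix-tree theorem for arrow fields -/

section MatrixTree

variable {V A : Type*} [Fintype V] [DecidableEq V] [Fintype A]

/-- The `0`-`1` row vector of a vertex, which is zero for the root. -/
def indicatorRow (u : Option V) (z : V) : ℝ := if u = some z then 1 else 0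

/-- The Laplacian of the graph in which the arrow `c` at `x` leads to `t x c` and has weight
`w x c`. -/
def arrowLaplacian (t : V → A → Option V) (w : V → A → ℝ) : Matrix V V ℝ :=
  fun x z => ∑ c, w x c * (indicatorRow (some x) z - indicatorRow (t x c) z)

lemma sum_indicatorRow_mul (u : Option V) (g : V → ℝ) :
    ∑ z, indicatorRow u z * g z = u.elim 0 g := by
  rcases u with _ | x
  · simp [indicatorRow]
  · simp [indicatorRow]

lemma det_rooted {f : V → Option V} (hf : Rooted f) :
    (Matrix.of fun x z => indicatorRow (some x) z - indicatorRow (f x) z).det = 1 := by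
  have hbt : Matrix.BlockTriangular
      (Matrix.of fun x z => indicatorRow (some x) z - indicatorRow (f x) z)
      (fun x => OrderDual.toDual (depth f (some x))) := by
    intro i j hij
    have hij' : depth f (some i) < depth f (some j) := hij
    have h1 : (some i : Option V) ≠ some j := fun h => by rw [h] at hij'; exact lt_irrefl _ hij'
    have h2 : f i ≠ some j := fun h => by
      rw [depth_some hf, h] at hij'
      omega
    simp [indicatorRow, h2, show i ≠ j from fun h => h1 (by rw [h])]
  rw [hbt.det]
  refine Finset.prod_eq_one fun k _ => ?_
  suffices h : Matrix.toSquareBlock (Matrix.of fun x z => indicatorRow (some x) z -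
      indicatorRow (f x) z) (fun x => OrderDual.toDual (depth f (some x))) k = 1 by
    rw [h, Matrix.det_one]
  ext ⟨i, hi⟩ ⟨j, hj⟩
  have h2 : f i ≠ some j := fun h => by
    have h3 : depth f (some i) = depth f (some j) := by
      rw [← hj] at hi
      exact hi
    rw [depth_some hf, h] at h3
    omega
  simp [Matrix.toSquareBlock, Matrix.toSquareBlockProp, indicatorRow, h2, Matrix.one_apply]

/-- If some orbit is infinite, the indicator of the vertices with an infinite orbit is in the
kernel. -/
lemma det_not_rooted {f : V → Option V} (hf : ¬ Rooted f) :
    (Matrix.of fun x z => indicatorRow (some x) z - indicatorRow (f x) z).det = 0 := by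
  classical
  refine Matrix.exists_mulVec_eq_zero_iff.1
    ⟨fun z => if ∃ n, (step f)^[n] (some z) = none then 0 else 1, ?_, ?_⟩
  · intro h0
    refine hf fun u => ?_
    rcases u with _ | x
    · exact ⟨0, rfl⟩
    · have := congrFun h0 x
      by_contra hx
      simp [hx] at this
  · ext x
    simp only [Matrix.mulVec, dotProduct, Matrix.of_apply, sub_mul, Finset.sum_sub_distrib,
      sum_indicatorRow_mul, Pi.zero_apply, Option.elim_some]
    have key : (∃ n, (step f)^[n] (some x) = none) ↔ ∃ n, (step f)^[n] (f x) = none := by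
      constructor
      · rintro ⟨_ | n, hn⟩
        · simp at hn
        · exact ⟨n, by rwa [Function.iterate_succ_apply] at hn⟩
      · rintro ⟨n, hn⟩
        exact ⟨n + 1, by rwa [Function.iterate_succ_apply]⟩
    rcases hfx : f x with _ | y
    · rw [hfx] at key
      simp [key.2 ⟨0, rfl⟩]
    · rw [hfx] at key
      simp [key]

open Classical in
/-- Expand the determinant row by row: each choice of one arrow per vertex contributes its weight
if it is rooted, and nothing otherwise. -/
theorem det_arrowLaplacian (t : V → A → Option V) (w : V → A → ℝ) :
    (arrowLaplacian t w).det =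
      ∑ b : V → A with Rooted fun x => t x (b x), ∏ x, w x (b x) := by
  have h : arrowLaplacian t w = fun x => ∑ c, w x c •
      fun z => (indicatorRow (some x) z - indicatorRow (t x c) z) := by
    ext x z
    simp [arrowLaplacian, Finset.sum_apply]
  have h2 := (Matrix.detRowAlternating (R := ℝ) (n := V)).toMultilinearMap.map_sum
    (fun x (c : A) => w x c • fun z => (indicatorRow (some x) z - indicatorRow (t x c) z))
  have h3 : (arrowLaplacian t w).det = ∑ r : V → A, (Matrix.detRowAlternating (R := ℝ) (n := V))
      (fun x => w x (r x) • fun z => (indicatorRow (some x) z - indicatorRow (t x (r x)) z)) := by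
    rw [h]; exact h2
  rw [h3, Finset.sum_filter]
  refine Finset.sum_congr rfl fun b _ => ?_
  have h4 := (Matrix.detRowAlternating (R := ℝ) (n := V)).toMultilinearMap.map_smul_univ
    (fun x => w x (b x)) (fun x z => (indicatorRow (some x) z - indicatorRow (t x (b x)) z))
  refine h4.trans ?_
  change _ • (Matrix.of fun x z => indicatorRow (some x) z - indicatorRow (t x (b x)) z).det = _
  split_ifs with hb
  · rw [det_rooted hb, smul_eq_mul, mul_one]
  · rw [det_not_rooted hb, smul_zero]

end MatrixTree

/-! ### Arrow fields on the lattice -/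

/-- The directions to the nearest neighbours of a site. -/
abbrev Dir (d : ℕ) : Type := {y : Site d // len y = 1}

lemma len_neg {d : ℕ} (y : Site d) : len (-y) = len y := by simp [len]

lemma len_single {d : ℕ} (i : Fin d) (s : ℤ) : len (Pi.single i s : Site d) = |s| := by
  unfold len
  rw [Finset.sum_eq_single i (fun j _ hj => by simp [hj]) (by simp)]
  simp

/-- The unit vector `± eᵢ`. -/
def unitVector {d : ℕ} (p : Fin d × Bool) : Dir d :=
  ⟨Pi.single p.1 (if p.2 then 1 else -1), by
    rw [len_single]
    split_ifs
    all_goals simp⟩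

lemma unitVector_bijective {d : ℕ} : Function.Bijective (unitVector (d := d)) := by
  constructor
  · rintro ⟨i, s⟩ ⟨j, t⟩ h
    have h1 : (Pi.single i (if s then 1 else -1) : Site d) = Pi.single j (if t then 1 else -1) :=
      congrArg Subtype.val h
    have hij : i = j := by
      by_contra hne
      have h2 := congrFun h1 i
      rw [Pi.single_eq_same, Pi.single_eq_of_ne hne] at h2
      split_ifs at h2
      all_goals simp at h2
    subst hij
    have h2 := congrFun h1 i
    rw [Pi.single_eq_same, Pi.single_eq_same] at h2
    cases s <;> cases t <;> simp_all
  · rintro ⟨y, hy⟩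
    have hy' : ∑ i, |y i| = 1 := hy
    obtain ⟨i, hi⟩ : ∃ i, y i ≠ 0 := by
      by_contra! h
      simp [h] at hy'
    rw [← Finset.add_sum_erase _ _ (Finset.mem_univ i)] at hy'
    have h1 : 1 ≤ |y i| := Int.one_le_abs hi
    have h2 : 0 ≤ ∑ j ∈ Finset.univ.erase i, |y j| := Finset.sum_nonneg fun _ _ => abs_nonneg _
    have h3 : ∑ j ∈ Finset.univ.erase i, |y j| = 0 := by omega
    have h4 : |y i| = 1 := by omega
    rw [Finset.sum_eq_zero_iff_of_nonneg fun _ _ => abs_nonneg _] at h3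
    refine ⟨(i, decide (y i = 1)), Subtype.ext ?_⟩
    ext j
    rcases eq_or_ne j i with rfl | hj
    · rcases eq_or_eq_neg_of_abs_eq h4 with h | h <;> simp [unitVector, h]
    · simp [unitVector, hj, abs_eq_zero.1 (h3 j (by simp [hj]))]

instance (d : ℕ) : Fintype (Dir d) := Fintype.ofBijective _ unitVector_bijective

lemma card_dir (d : ℕ) : Fintype.card (Dir d) = 2 * d := by
  rw [← Fintype.card_of_bijective (unitVector_bijective (d := d))]
  simp [mul_comm]

lemma setOf_len_finite (d : ℕ) : {y : Site d | len y = 1}.Finite :=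
  Set.finite_coe_iff.1 (inferInstanceAs (Finite (Dir d)))

/-- An arrow at a site: a direction, or `none` for the dissipative edge. -/
abbrev Arrow (d : ℕ) : Type := Option (Dir d)

/-- The finite set of arrows carries the discrete topology and the discrete `σ`-algebra. -/
instance (d : ℕ) : TopologicalSpace (Arrow d) := ⊥
instance (d : ℕ) : DiscreteTopology (Arrow d) := ⟨rfl⟩
instance (d : ℕ) : MeasurableSpace (Arrow d) := ⊤
instance (d : ℕ) : DiscreteMeasurableSpace (Arrow d) := ⟨fun _ => trivial⟩
instance (d : ℕ) : BorelSpace (Arrow d) := ⟨by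
  refine le_antisymm (fun s _ => ?_) le_top
  exact MeasurableSpace.measurableSet_generateFrom (isOpen_discrete s)⟩

/-- Arrow fields on the lattice. -/
abbrev ArrowField (d : ℕ) : Type := Site d → Arrow d

/-- The end of the arrow `c` at `x`. -/
def target {d : ℕ} (x : Site d) (c : Arrow d) : Option (Site d) := c.map fun y => x + y.1

/-- The map along the arrows of `a`. -/
def next {d : ℕ} (a : ArrowField d) (x : Site d) : Option (Site d) := target x (a x)

/-- The map along the arrows of a field on `Λ`, with the outside of `Λ` as root. -/
def nextIn {d : ℕ} (Λ : Finset (Site d)) (b : Λ → Arrow d) (x : Λ) : Option Λ :=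
  collapse Λ (target x.1 (b x))

/-- The extension of a field on `Λ` by dissipative arrows. -/
def extendNone {d : ℕ} (Λ : Finset (Site d)) (b : Λ → Arrow d) : ArrowField d :=
  fun x => if h : x ∈ Λ then b ⟨x, h⟩ else none

/-- Dissipative arrows have weight `γ`, all others weight `1`. -/
def arrowWeight {d : ℕ} (γ : ℝ) (c : Arrow d) : ℝ := c.elim γ fun _ => 1

/-- The weight of a field. -/
def fieldWeight {d : ℕ} (γ : ℝ) {Λ : Finset (Site d)} (b : Λ → Arrow d) : ℝ :=
  ∏ x, arrowWeight γ (b x)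

open Classical in
/-- The fields on `Λ` all of whose paths leave `Λ`. They encode the spanning trees. -/
def rootedFields {d : ℕ} (Λ : Finset (Site d)) : Finset (Λ → Arrow d) :=
  {b | Rooted (nextIn Λ b)}

lemma arrowWeight_pos {d : ℕ} {γ : ℝ} (hγ : 0 < γ) (c : Arrow d) : 0 < arrowWeight γ c := by
  rcases c with _ | y
  · exact hγ
  · exact one_pos

lemma fieldWeight_pos {d : ℕ} {γ : ℝ} (hγ : 0 < γ) {Λ : Finset (Site d)} (b : Λ → Arrow d) :
    0 < fieldWeight γ b := Finset.prod_pos fun _ _ => arrowWeight_pos hγ _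

lemma none_mem_rootedFields {d : ℕ} (Λ : Finset (Site d)) : (fun _ => none) ∈ rootedFields Λ := by
  simp only [rootedFields, Finset.mem_filter, Finset.mem_univ, true_and]
  rintro (_ | x)
  · exact ⟨0, rfl⟩
  · exact ⟨1, rfl⟩

/-- The total weight of the rooted fields. -/
def partitionFunction {d : ℕ} (γ : ℝ) (Λ : Finset (Site d)) : ℝ :=
  ∑ b ∈ rootedFields Λ, fieldWeight γ b

lemma partitionFunction_pos {d : ℕ} {γ : ℝ} (hγ : 0 < γ) (Λ : Finset (Site d)) :
    0 < partitionFunction γ Λ :=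
  Finset.sum_pos (fun _ _ => fieldWeight_pos hγ _) ⟨_, none_mem_rootedFields Λ⟩

/-- The unnormalized measure on rooted fields. -/
def fieldSum {d : ℕ} (γ : ℝ) (Λ : Finset (Site d)) : Measure (Λ → Arrow d) :=
  ∑ b ∈ rootedFields Λ, ENNReal.ofReal (fieldWeight γ b) • Measure.dirac b

/-- The probability measure on rooted fields proportional to the weight. -/
def fieldMeasure {d : ℕ} (γ : ℝ) (Λ : Finset (Site d)) : Measure (Λ → Arrow d) :=
  (fieldSum γ Λ Set.univ)⁻¹ • fieldSum γ Λ

open Classical in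
lemma fieldSum_apply {d : ℕ} {γ : ℝ} (hγ : 0 < γ) (Λ : Finset (Site d)) (A : Set (Λ → Arrow d)) :
    fieldSum γ Λ A = ENNReal.ofReal (∑ b ∈ rootedFields Λ with b ∈ A, fieldWeight γ b) := by
  rw [ENNReal.ofReal_sum_of_nonneg fun _ _ => (fieldWeight_pos hγ _).le, Finset.sum_filter]
  simp only [fieldSum, Measure.coe_finsetSum, Finset.sum_apply, Measure.smul_apply, smul_eq_mul,
    Measure.dirac_apply, Set.indicator_apply, Pi.one_apply, mul_ite, mul_one, mul_zero]

lemma fieldSum_univ {d : ℕ} {γ : ℝ} (hγ : 0 < γ) (Λ : Finset (Site d)) :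
    fieldSum γ Λ Set.univ = ENNReal.ofReal (partitionFunction γ Λ) := by
  rw [fieldSum_apply hγ]
  simp [partitionFunction]

open Classical in
lemma fieldMeasure_apply {d : ℕ} {γ : ℝ} (hγ : 0 < γ) (Λ : Finset (Site d))
    (A : Set (Λ → Arrow d)) : fieldMeasure γ Λ A =
      ENNReal.ofReal ((∑ b ∈ rootedFields Λ with b ∈ A, fieldWeight γ b) /
        partitionFunction γ Λ) := by
  rw [fieldMeasure, Measure.smul_apply, fieldSum_univ hγ, fieldSum_apply hγ, smul_eq_mul,
    ENNReal.ofReal_div_of_pos (partitionFunction_pos hγ Λ), ENNReal.div_eq_inv_mul]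

lemma isProbabilityMeasure_fieldMeasure {d : ℕ} {γ : ℝ} (hγ : 0 < γ) (Λ : Finset (Site d)) :
    IsProbabilityMeasure (fieldMeasure γ Λ) := by
  refine ⟨?_⟩
  rw [fieldMeasure, Measure.smul_apply, fieldSum_univ hγ, smul_eq_mul]
  exact ENNReal.inv_mul_cancel (by simpa using partitionFunction_pos hγ Λ) ENNReal.ofReal_ne_top

/-! ### Green's function and its thermodynamic limit -/

/-- A function that is non-negative off `Λ` and superharmonic on `Λ` is non-negative: consider
its minimum. -/
lemma nonneg_of_superharmonic {d : ℕ} {γ : ℝ} (hγ : 0 < γ) (Λ : Finset (Site d)) (f : Site d → ℝ)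
    (hout : ∀ x ∉ Λ, 0 ≤ f x)
    (hin : ∀ x ∈ Λ, 0 ≤ γ * f x + ∑ e : Dir d, (f x - f (x + e.1))) (x : Site d) : 0 ≤ f x := by
  by_contra! hx
  have hxΛ : x ∈ Λ := by
    by_contra h
    exact absurd (hout x h) (not_le.2 hx)
  obtain ⟨m, hm, hmin⟩ := Λ.exists_min_image f ⟨x, hxΛ⟩
  have hneg : f m < 0 := (hmin x hxΛ).trans_lt hx
  have hall : ∀ y, f m ≤ f y := fun y => by
    by_cases hy : y ∈ Λ
    · exact hmin y hy
    · exact hneg.le.trans (hout y hy)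
  have h1 : ∑ e : Dir d, (f m - f (m + e.1)) ≤ 0 :=
    Finset.sum_nonpos fun e _ => sub_nonpos.2 (hall _)
  have h2 := hin m hm
  have h3 : γ * f m < 0 := mul_neg_of_pos_of_neg hγ hneg
  linarith

/-- The Laplacian on `Λ` with killing off `Λ` and mass `γ`. -/
def laplacian {d : ℕ} (γ : ℝ) (Λ : Finset (Site d)) : Matrix Λ Λ ℝ :=
  arrowLaplacian (fun x c => collapse Λ (target x.1 c)) fun _ c => arrowWeight γ c

lemma det_laplacian {d : ℕ} (γ : ℝ) (Λ : Finset (Site d)) :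
    (laplacian γ Λ).det = partitionFunction γ Λ :=
  det_arrowLaplacian _ _

/-- Green's function on `Λ`, extended by zero. -/
def green {d : ℕ} (γ : ℝ) (Λ : Finset (Site d)) (x y : Site d) : ℝ :=
  if h : x ∈ Λ ∧ y ∈ Λ then (laplacian γ Λ)⁻¹ ⟨x, h.1⟩ ⟨y, h.2⟩ else 0

lemma collapse_elim_green {d : ℕ} (γ : ℝ) (Λ : Finset (Site d)) (u : Option (Site d)) (y : Λ) :
    ((collapse Λ u).elim 0 fun z => (laplacian γ Λ)⁻¹ z y) =
      u.elim 0 fun z => green γ Λ z y.1 := by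
  rcases u with _ | z
  · rfl
  · by_cases hz : z ∈ Λ
    · simp [collapse, green, hz]
    · simp [collapse, green, hz]

/-- Multiplication by Green's function turns the row of an arrow into a difference of Green's
functions at its two ends. -/
lemma arrowLaplacian_mul_inv {d : ℕ} (γ : ℝ) (Λ : Finset (Site d)) (w : Λ → Arrow d → ℝ)
    (x y : Λ) :
    (arrowLaplacian (fun x c => collapse Λ (target x.1 c)) w * (laplacian γ Λ)⁻¹) x y =
      ∑ c, w x c * (green γ Λ x.1 y.1 - (target x.1 c).elim 0 fun z => green γ Λ z y.1) := by
  have hx : green γ Λ x.1 y.1 = (laplacian γ Λ)⁻¹ x y := by simp [green]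
  simp only [Matrix.mul_apply, arrowLaplacian, Finset.sum_mul]
  rw [Finset.sum_comm]
  refine Finset.sum_congr rfl fun c _ => ?_
  simp only [mul_assoc, ← Finset.mul_sum, sub_mul, Finset.sum_sub_distrib, sum_indicatorRow_mul,
    collapse_elim_green, hx, Option.elim_some]

lemma laplacian_mul_inv {d : ℕ} {γ : ℝ} (hγ : 0 < γ) (Λ : Finset (Site d)) :
    laplacian γ Λ * (laplacian γ Λ)⁻¹ = 1 :=
  Matrix.mul_nonsing_inv _ (by
    rw [det_laplacian]
    exact (partitionFunction_pos hγ Λ).ne'.isUnit)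

lemma green_equation {d : ℕ} {γ : ℝ} (hγ : 0 < γ) {Λ : Finset (Site d)} {x y : Site d}
    (hx : x ∈ Λ) (hy : y ∈ Λ) :
    γ * green γ Λ x y + ∑ e : Dir d, (green γ Λ x y - green γ Λ (x + e.1) y) =
      if x = y then 1 else 0 := by
  have h := (arrowLaplacian_mul_inv γ Λ (fun _ c => arrowWeight γ c) ⟨x, hx⟩ ⟨y, hy⟩).symm.trans
    (congrFun (congrFun (laplacian_mul_inv hγ Λ) ⟨x, hx⟩) ⟨y, hy⟩)
  rw [Fintype.sum_option] at h
  simpa [arrowWeight, target, Matrix.one_apply] using h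

lemma green_eq_zero {d : ℕ} (γ : ℝ) {Λ : Finset (Site d)} {x : Site d} (y : Site d)
    (hx : x ∉ Λ) : green γ Λ x y = 0 := by simp [green, hx]

lemma green_eq_zero' {d : ℕ} (γ : ℝ) {Λ : Finset (Site d)} (x : Site d) {y : Site d}
    (hy : y ∉ Λ) : green γ Λ x y = 0 := by simp [green, hy]

lemma green_nonneg {d : ℕ} {γ : ℝ} (hγ : 0 < γ) (Λ : Finset (Site d)) (x y : Site d) :
    0 ≤ green γ Λ x y := by
  by_cases hy : y ∈ Λ
  · refine nonneg_of_superharmonic hγ Λ (fun x => green γ Λ x y)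
      (fun x hx => (green_eq_zero γ y hx).ge) (fun x hx => ?_) x
    rw [green_equation hγ hx hy]
    split_ifs <;> simp
  · rw [green_eq_zero' γ x hy]

lemma green_mono {d : ℕ} {γ : ℝ} (hγ : 0 < γ) (x y : Site d) :
    Monotone fun Λ => green γ Λ x y := by
  intro Λ Λ' hΛ
  by_cases hy : y ∈ Λ
  · have := nonneg_of_superharmonic hγ Λ (fun x => green γ Λ' x y - green γ Λ x y)
      (fun x hx => by rw [green_eq_zero γ y hx, sub_zero]; exact green_nonneg hγ _ _ _)
      (fun x hx => ?_) x
    · exact sub_nonneg.1 this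
    · have h1 := green_equation hγ hx hy
      have h2 := green_equation hγ (hΛ hx) (hΛ hy)
      simp only [Finset.sum_sub_distrib] at h1 h2 ⊢
      linarith
  · simp only [green_eq_zero' γ x hy]
    exact green_nonneg hγ _ _ _

lemma green_le {d : ℕ} {γ : ℝ} (hγ : 0 < γ) (Λ : Finset (Site d)) (x y : Site d) :
    green γ Λ x y ≤ γ⁻¹ := by
  by_cases hy : y ∈ Λ
  · have := nonneg_of_superharmonic hγ Λ (fun x => γ⁻¹ - green γ Λ x y)
      (fun x hx => by rw [green_eq_zero γ y hx, sub_zero]; exact (inv_pos.2 hγ).le)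
      (fun x hx => ?_) x
    · exact sub_nonneg.1 this
    · have h1 := green_equation hγ hx hy
      have h2 : γ * γ⁻¹ = 1 := mul_inv_cancel₀ hγ.ne'
      have h3 : (if x = y then (1 : ℝ) else 0) ≤ 1 := by split_ifs <;> simp
      simp only [Finset.sum_sub_distrib] at h1 ⊢
      linarith
  · rw [green_eq_zero' γ x hy]
    exact (inv_pos.2 hγ).le

lemma exists_tendsto_green {d : ℕ} {γ : ℝ} (hγ : 0 < γ) (x y : Site d) :
    ∃ l, Tendsto (fun Λ => green γ Λ x y) atTop (𝓝 l) :=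
  ⟨_, tendsto_atTop_ciSup (green_mono hγ x y) ⟨γ⁻¹, by
    rintro _ ⟨Λ, rfl⟩
    exact green_le hγ Λ x y⟩⟩

/-! ### Cylinder probabilities -/

/-- The matrix whose determinant is the probability that the arrows on `S` are those of `c`. -/
def cylinderMatrix {d : ℕ} (γ : ℝ) (Λ S : Finset (Site d)) (c : ArrowField d) : Matrix S S ℝ :=
  fun x y => arrowWeight γ (c x.1) *
    (green γ Λ x.1 y.1 - (next c x.1).elim 0 fun z => green γ Λ z y.1)

/-- The weight of the fields with prescribed arrows on `S` is the determinant of the Laplacian with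
modified rows, and only the block on `S` of its product with Green's function is not trivial. -/
lemma fieldMeasure_cylinder {d : ℕ} {γ : ℝ} (hγ : 0 < γ) {Λ S : Finset (Site d)} (hS : S ⊆ Λ)
    (c : ArrowField d) : fieldMeasure γ Λ {b | ∀ x ∈ S, extendNone Λ b x = c x} =
      ENNReal.ofReal (cylinderMatrix γ Λ S c).det := by
  classical
  rw [fieldMeasure_apply hγ]
  congr 1
  set w : Λ → Arrow d → ℝ := fun x e => if x.1 ∈ S → e = c x.1 then arrowWeight γ e else 0 with hw
  have h1 : (∑ b ∈ rootedFields Λ with b ∈ {b | ∀ x ∈ S, extendNone Λ b x = c x},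
      fieldWeight γ b) = (arrowLaplacian (fun x c => collapse Λ (target x.1 c)) w).det := by
    rw [det_arrowLaplacian, Finset.sum_filter]
    refine Finset.sum_congr (by unfold rootedFields; rfl) fun b _ => ?_
    split_ifs with h
    · refine Finset.prod_congr rfl fun x _ => ?_
      simp only [hw]
      rw [if_pos]
      intro hx
      have := h x.1 hx
      simpa [extendNone] using this
    · simp only [Set.mem_ofPred_eq] at h
      push Not at h
      obtain ⟨x, hx, hne⟩ := h
      refine (Finset.prod_eq_zero (Finset.mem_univ ⟨x, hS hx⟩) ?_).symm
      simp only [hw]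
      rw [if_neg]
      simpa [extendNone, hx, hS hx] using hne
  set N := arrowLaplacian (fun x c => collapse Λ (target x.1 c)) w * (laplacian γ Λ)⁻¹ with hN
  have h2 : (∑ b ∈ rootedFields Λ with b ∈ {b | ∀ x ∈ S, extendNone Λ b x = c x},
      fieldWeight γ b) / partitionFunction γ Λ = N.det := by
    rw [h1, hN, Matrix.det_mul, Matrix.det_nonsing_inv, det_laplacian, Ring.inverse_eq_inv',
      div_eq_mul_inv]
  trans N.det
  · convert h2
  have hout : ∀ x : Λ, x.1 ∉ S → ∀ y, N x y = (1 : Matrix Λ Λ ℝ) x y := by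
    intro x hx y
    rw [← laplacian_mul_inv hγ Λ, hN, arrowLaplacian_mul_inv]
    refine Eq.trans ?_ (arrowLaplacian_mul_inv γ Λ (fun _ c => arrowWeight γ c) x y).symm
    simp [hw, hx]
  have hins : ∀ x : Λ, x.1 ∈ S → ∀ y, N x y = arrowWeight γ (c x.1) *
      (green γ Λ x.1 y.1 - (next c x.1).elim 0 fun z => green γ Λ z y.1) := by
    intro x hx y
    rw [hN, arrowLaplacian_mul_inv, Finset.sum_eq_single (c x.1)]
    · simp [hw, next]
    · intro e _ he
      simp [hw, hx, he]
    · simp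
  rw [Matrix.twoBlockTriangular_det N (fun x => x.1 ∈ S) (fun i hi j hj => by
    rw [hout i hi, Matrix.one_apply_ne]
    rintro rfl
    exact hi hj)]
  have h3 : Matrix.toSquareBlockProp N (fun x => ¬ x.1 ∈ S) = 1 := by
    ext i j
    rw [Matrix.toSquareBlockProp_def, Matrix.of_apply, hout i.1 i.2]
    exact if_congr Subtype.ext_iff.symm rfl rfl
  rw [h3, Matrix.det_one, mul_one]
  let e : S ≃ {x : Λ // x.1 ∈ S} :=
    { toFun := fun x => ⟨⟨x.1, hS x.2⟩, x.2⟩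
      invFun := fun x => ⟨x.1.1, x.2⟩
      left_inv := fun _ => rfl
      right_inv := fun _ => rfl }
  rw [← Matrix.det_submatrix_equiv_self e]
  congr 1
  ext x y
  simp only [Matrix.submatrix_apply, Matrix.toSquareBlockProp_def, Matrix.of_apply]
  rw [hins _ (e x).2]
  rfl

lemma exists_tendsto_cylinder {d : ℕ} {γ : ℝ} (hγ : 0 < γ) (S : Finset (Site d))
    (c : ArrowField d) : ∃ l, Tendsto
      (fun Λ => fieldMeasure γ Λ {b | ∀ x ∈ S, extendNone Λ b x = c x}) atTop (𝓝 l) := by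
  choose g hg using fun x y : Site d => exists_tendsto_green hγ x y
  refine ⟨ENNReal.ofReal (Matrix.det fun x y : S => arrowWeight γ (c x.1) *
    (g x.1 y.1 - (next c x.1).elim 0 fun z => g z y.1)), ?_⟩
  have h1 : Tendsto (fun Λ => ENNReal.ofReal (cylinderMatrix γ Λ S c).det) atTop
      (𝓝 (ENNReal.ofReal (Matrix.det fun x y : S => arrowWeight γ (c x.1) *
        (g x.1 y.1 - (next c x.1).elim 0 fun z => g z y.1)))) := by
    refine ENNReal.tendsto_ofReal ((Continuous.matrix_det continuous_id).continuousAt.tendsto.comp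
      (tendsto_pi_nhds.2 fun x => tendsto_pi_nhds.2 fun y => ?_))
    refine ((hg _ _).sub ?_).const_mul _
    rcases next c x.1 with _ | z
    · exact tendsto_const_nhds
    · exact hg z y.1
  refine h1.congr' ?_
  filter_upwards [eventually_ge_atTop S] with Λ hΛ
  exact (fieldMeasure_cylinder hγ hΛ c).symm

/-! ### Paths to the root have exponentially small tails -/

lemma depth_eq_depth_iterate_add {V : Type*} {f : V → Option V} (hf : Rooted f) {u : Option V}
    {y : V} {j : ℕ} (h : (step f)^[j] u = some y) : depth f u = depth f (some y) + j := by
  induction j generalizing u with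
  | zero => simpa using congrArg (depth f) h
  | succ j ih =>
    rcases u with _ | x
    · simp at h
    · rw [Function.iterate_succ_apply] at h
      rw [depth_some hf, show f x = step f (some x) from rfl, ih h]
      ring

/-- Redirecting arrows to the root keeps a map rooted. -/
lemma Rooted.of_eq_or_none {V : Type*} {f g : V → Option V} (hf : Rooted f)
    (h : ∀ x, g x = f x ∨ g x = none) : Rooted g := by
  have key : ∀ n u, depth f u = n → ∃ m, (step g)^[m] u = none := by
    intro n
    induction n with
    | zero =>
      rintro (_ | x) hu
      · exact ⟨0, rfl⟩
      · rw [depth_some hf] at hu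
        omega
    | succ n ih =>
      rintro (_ | x) hu
      · exact ⟨0, rfl⟩
      · rcases h x with hx | hx
        · rw [depth_some hf] at hu
          obtain ⟨m, hm⟩ := ih (f x) (by omega)
          exact ⟨m + 1, by rwa [Function.iterate_succ_apply, step_some, hx]⟩
        · exact ⟨1, hx⟩
  exact fun u => key _ u rfl

lemma extendNone_of_mem {d : ℕ} {Λ : Finset (Site d)} (b : Λ → Arrow d) {x : Site d} (hx : x ∈ Λ) :
    extendNone Λ b x = b ⟨x, hx⟩ := dif_pos hx

lemma extendNone_of_notMem {d : ℕ} {Λ : Finset (Site d)} (b : Λ → Arrow d) {x : Site d}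
    (hx : x ∉ Λ) : extendNone Λ b x = none := dif_neg hx

lemma rooted_next_extendNone {d : ℕ} {Λ : Finset (Site d)} {b : Λ → Arrow d}
    (hb : Rooted (nextIn Λ b)) : Rooted (next (extendNone Λ b)) := by
  have key : ∀ n x, depth (nextIn Λ b) (collapse Λ x) = n →
      ∃ m, (step (next (extendNone Λ b)))^[m] x = none := by
    intro n
    induction n using Nat.strong_induction_on with
    | _ n ih =>
      rintro (_ | x) hx
      · exact ⟨0, rfl⟩
      · by_cases hxΛ : x ∈ Λ
        · have h1 : collapse Λ (some x) = some ⟨x, hxΛ⟩ := dif_pos hxΛ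
          rw [h1, depth_some hb] at hx
          have h2 : collapse Λ (next (extendNone Λ b) x) = nextIn Λ b ⟨x, hxΛ⟩ := by
            rw [next, extendNone_of_mem b hxΛ]
            rfl
          obtain ⟨m, hm⟩ := ih _ (by omega) (next (extendNone Λ b) x) (congrArg _ h2)
          exact ⟨m + 1, by rwa [Function.iterate_succ_apply]⟩
        · exact ⟨1, by simp [next, extendNone_of_notMem b hxΛ, target]⟩
  exact fun u => key _ u rfl

lemma mem_rootedFields {d : ℕ} {Λ : Finset (Site d)} {b : Λ → Arrow d} :
    b ∈ rootedFields Λ ↔ Rooted (nextIn Λ b) := by simp [rootedFields]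

lemma fieldWeight_update_none {d : ℕ} {γ : ℝ} {Λ : Finset (Site d)} [DecidableEq Λ]
    {b : Λ → Arrow d}
    {z : Λ} {e : Dir d} (h : b z = some e) :
    fieldWeight γ (Function.update b z none) = γ * fieldWeight γ b := by
  unfold fieldWeight
  rw [← Finset.mul_prod_erase _ _ (Finset.mem_univ z), ← Finset.mul_prod_erase (a := z)
    (f := fun x => arrowWeight γ (b x)) _ (Finset.mem_univ z), Function.update_self, h]
  have : ∏ x ∈ Finset.univ.erase z, arrowWeight γ (Function.update b z none x) =
      ∏ x ∈ Finset.univ.erase z, arrowWeight γ (b x) :=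
    Finset.prod_congr rfl fun x hx => by
      rw [Function.update_of_ne (Finset.ne_of_mem_erase hx)]
  rw [this]
  simp [arrowWeight]

open Classical in
/-- The rooted fields on `Λ` whose path from `x` takes more than `N` steps. -/
def longPathFields {d : ℕ} (Λ : Finset (Site d)) (x : Site d) (N : ℕ) : Finset (Λ → Arrow d) :=
  {b ∈ rootedFields Λ | (step (next (extendNone Λ b)))^[N] (some x) ≠ none}

open Classical in
/-- Redirecting the arrow at the `N`-th site of the path to the root is injective up to the
choice of the old direction, and multiplies the weight by `γ`. -/
lemma weight_longPathFields_succ {d : ℕ} {γ : ℝ} (hγ : 0 < γ) (Λ : Finset (Site d)) (x : Site d)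
    (N : ℕ) : γ * ∑ b ∈ longPathFields Λ x (N + 1), fieldWeight γ b ≤
      2 * d * (∑ b ∈ longPathFields Λ x N, fieldWeight γ b -
        ∑ b ∈ longPathFields Λ x (N + 1), fieldWeight γ b) := by
  have hsub : longPathFields Λ x (N + 1) ⊆ longPathFields Λ x N := by
    intro b hb
    simp only [longPathFields, Finset.mem_filter] at hb ⊢
    exact ⟨hb.1, fun h => hb.2 (iterate_step_eq_none_of_le N.le_succ h)⟩
  rw [← Finset.sum_sdiff hsub, add_sub_cancel_right]
  have hz : ∀ b ∈ longPathFields Λ x (N + 1), ∃ z : Λ, ∃ e : Dir d,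
      (step (next (extendNone Λ b)))^[N] (some x) = some z.1 ∧ b z = some e := by
    intro b hb
    simp only [longPathFields, Finset.mem_filter, Function.iterate_succ_apply'] at hb
    rcases hpos : (step (next (extendNone Λ b)))^[N] (some x) with _ | z
    · rw [hpos] at hb
      exact absurd rfl hb.2
    · rw [hpos, step_some, next] at hb
      have hzΛ : z ∈ Λ := by
        by_contra h
        rw [extendNone_of_notMem b h] at hb
        exact hb.2 rfl
      rw [extendNone_of_mem b hzΛ] at hb
      rcases he : b ⟨z, hzΛ⟩ with _ | e
      · rw [he] at hb
        exact absurd rfl hb.2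
      · exact ⟨⟨z, hzΛ⟩, e, rfl, he⟩
  rcases (longPathFields Λ x (N + 1)).eq_empty_or_nonempty with hempty | ⟨b₀, hb₀⟩
  · rw [hempty, Finset.sum_empty, mul_zero]
    exact mul_nonneg (by positivity) (Finset.sum_nonneg fun _ _ => (fieldWeight_pos hγ _).le)
  obtain ⟨z₀, e₀, -, -⟩ := hz b₀ hb₀
  have : Nonempty Λ := ⟨z₀⟩
  have : Nonempty (Dir d) := ⟨e₀⟩
  choose! z e hpos harr using hz
  have hrooted : ∀ b ∈ longPathFields Λ x (N + 1), Rooted (nextIn Λ b) := fun b hb =>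
    mem_rootedFields.1 (Finset.mem_filter.1 hb).1
  -- the redirected field has the same first `N` steps, as the path does not visit a site twice
  have hpos' : ∀ b ∈ longPathFields Λ x (N + 1), ∀ j ≤ N,
      (step (next (extendNone Λ (Function.update b (z b) none))))^[j] (some x) =
        (step (next (extendNone Λ b)))^[j] (some x) := by
    intro b hb j
    induction j with
    | zero => intro _; rfl
    | succ j ih =>
      intro hj
      rw [Function.iterate_succ_apply', Function.iterate_succ_apply', ih (by omega)]
      rcases hy : (step (next (extendNone Λ b)))^[j] (some x) with _ | y
      · rfl
      · have hyz : y ≠ (z b).1 := by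
          rintro rfl
          have hr := rooted_next_extendNone (hrooted b hb)
          have h1 := depth_eq_depth_iterate_add hr hy
          have h2 := depth_eq_depth_iterate_add hr (hpos b hb)
          omega
        rw [step_some, step_some, next, next]
        congr 1
        by_cases hyΛ : y ∈ Λ
        · rw [extendNone_of_mem _ hyΛ, extendNone_of_mem _ hyΛ, Function.update_of_ne]
          exact fun h => hyz (congrArg Subtype.val h)
        · rw [extendNone_of_notMem _ hyΛ, extendNone_of_notMem _ hyΛ]
  have hmem : ∀ b ∈ longPathFields Λ x (N + 1), Function.update b (z b) none ∈
      longPathFields Λ x N \ longPathFields Λ x (N + 1) := by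
    intro b hb
    have h1 : Rooted (nextIn Λ (Function.update b (z b) none)) := by
      refine (hrooted b hb).of_eq_or_none fun y => ?_
      by_cases hy : y = z b
      · right
        subst hy
        rw [nextIn, Function.update_self]
        rfl
      · left
        rw [nextIn, nextIn, Function.update_of_ne hy]
    simp only [longPathFields, Finset.mem_sdiff, Finset.mem_filter, mem_rootedFields, h1, true_and,
      not_not, Function.iterate_succ_apply', hpos' b hb N le_rfl, hpos b hb, step_some, next,
      extendNone_of_mem _ (z b).2, Function.update_self]
    exact ⟨Option.some_ne_none _, rfl⟩
  have hinj : Set.InjOn (fun b => (Function.update b (z b) none, e b))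
      (longPathFields Λ x (N + 1)) := by
    intro b hb b' hb' h
    obtain ⟨h1, h2⟩ := Prod.mk.inj h
    have h3 : z b = z b' := by
      have h4 := hpos' b hb N le_rfl
      have h5 := hpos' b' hb' N le_rfl
      rw [hpos b hb, h1] at h4
      rw [hpos b' hb', h4] at h5
      exact Subtype.ext (Option.some_injective _ h5)
    funext y
    by_cases hy : y = z b
    · rw [hy, harr b hb, h2, h3, harr b' hb']
    · have := congrFun h1 y
      rwa [Function.update_of_ne hy, Function.update_of_ne (h3 ▸ hy)] at this
  calc γ * ∑ b ∈ longPathFields Λ x (N + 1), fieldWeight γ b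
      = ∑ b ∈ longPathFields Λ x (N + 1), fieldWeight γ (Function.update b (z b) none) := by
        rw [Finset.mul_sum]
        exact Finset.sum_congr rfl fun b hb => (fieldWeight_update_none (harr b hb)).symm
    _ = ∑ p ∈ (longPathFields Λ x (N + 1)).image
          (fun b => (Function.update b (z b) none, e b)), fieldWeight γ p.1 :=
        (Finset.sum_image (f := fun p : (Λ → Arrow d) × Dir d => fieldWeight γ p.1) hinj).symm
    _ ≤ ∑ p ∈ (longPathFields Λ x N \ longPathFields Λ x (N + 1)) ×ˢ
          (Finset.univ : Finset (Dir d)), fieldWeight γ p.1 := by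
        refine Finset.sum_le_sum_of_subset_of_nonneg ?_ fun _ _ _ => (fieldWeight_pos hγ _).le
        intro p hp
        obtain ⟨b, hb, rfl⟩ := Finset.mem_image.1 hp
        exact Finset.mem_product.2 ⟨hmem b hb, Finset.mem_univ _⟩
    _ = 2 * d * ∑ b ∈ longPathFields Λ x N \ longPathFields Λ x (N + 1), fieldWeight γ b := by
        rw [Finset.sum_product]
        simp [card_dir, Finset.mul_sum]

lemma weight_longPathFields_le {d : ℕ} {γ : ℝ} (hγ : 0 < γ) (Λ : Finset (Site d)) (x : Site d)
    (N : ℕ) : ∑ b ∈ longPathFields Λ x N, fieldWeight γ b ≤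
      (2 * d / (2 * d + γ)) ^ N * partitionFunction γ Λ := by
  have hpos : 0 < 2 * (d : ℝ) + γ := by positivity
  induction N with
  | zero =>
    rw [pow_zero, one_mul]
    exact Finset.sum_le_sum_of_subset_of_nonneg (Finset.filter_subset _ _)
      fun _ _ _ => (fieldWeight_pos hγ _).le
  | succ N ih =>
    have h := weight_longPathFields_succ hγ Λ x N
    have h2 : ∑ b ∈ longPathFields Λ x (N + 1), fieldWeight γ b ≤
        2 * d / (2 * d + γ) * ∑ b ∈ longPathFields Λ x N, fieldWeight γ b := by
      rw [div_mul_eq_mul_div, le_div_iff₀ hpos]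
      linarith
    refine h2.trans ?_
    rw [pow_succ', mul_assoc]
    exact mul_le_mul_of_nonneg_left ih (by positivity)

/-- The bound is uniform in `Λ`. -/
lemma fieldMeasure_longPath_le {d : ℕ} {γ : ℝ} (hγ : 0 < γ) (Λ : Finset (Site d)) (x : Site d)
    (N : ℕ) : fieldMeasure γ Λ {b | (step (next (extendNone Λ b)))^[N] (some x) ≠ none} ≤
      ENNReal.ofReal ((2 * d / (2 * d + γ)) ^ N) := by
  classical
  rw [fieldMeasure_apply hγ]
  refine ENNReal.ofReal_le_ofReal ?_
  rw [div_le_iff₀ (partitionFunction_pos hγ Λ)]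
  refine le_trans (le_of_eq ?_) (weight_longPathFields_le hγ Λ x N)
  unfold longPathFields
  exact Finset.sum_congr (by ext; simp) fun _ _ => rfl

lemma tendsto_tail {d : ℕ} {γ : ℝ} (hγ : 0 < γ) :
    Tendsto (fun N : ℕ => ENNReal.ofReal ((2 * d / (2 * d + γ)) ^ N)) atTop (𝓝 0) := by
  rw [← ENNReal.ofReal_zero]
  refine ENNReal.tendsto_ofReal (tendsto_pow_atTop_nhds_zero_of_lt_one (by positivity) ?_)
  rw [div_lt_one (by positivity)]
  linarith

/-! ### Weak convergence on products of finite spaces -/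

section WeakConvergence

lemma isClopen_cylinder {ι β : Type*} [TopologicalSpace β] [DiscreteTopology β]
    (S : Finset ι) (c : ι → β) :
    IsClopen {a : ι → β | ∀ x ∈ S, a x = c x} := by
  have : {a : ι → β | ∀ x ∈ S, a x = c x} = ⋂ x ∈ S, (fun a : ι → β => a x) ⁻¹' {c x} := by
    ext a
    simp
  rw [this]
  exact S.finite_toSet.isClopen_biInter fun x _ =>
    (isClopen_discrete {c x}).preimage (continuous_apply x)

variable {ι β : Type*} [Countable ι] [Finite β] [MeasurableSpace β] [TopologicalSpace β]
  [DiscreteTopology β] [BorelSpace β] {T : Type*} {l : Filter T}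

/-- Probability measures that agree on cylinders are equal. -/
lemma ext_of_cylinder {P Q : Measure (ι → β)} [IsProbabilityMeasure P] [IsProbabilityMeasure Q]
    (h : ∀ (S : Finset ι) (c : ι → β), P {a | ∀ x ∈ S, a x = c x} = Q {a | ∀ x ∈ S, a x = c x}) :
    P = Q := by
  have hP : IsProjectiveLimit P fun S : Finset ι => P.map S.restrict := fun _ => rfl
  refine hP.unique fun S => ?_
  refine Measure.ext_of_singleton fun s => ?_
  have hm : Measurable (S.restrict (π := fun _ : ι => β)) := S.measurable_restrict
  rw [Measure.map_apply hm (measurableSet_singleton s),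
    Measure.map_apply hm (measurableSet_singleton s)]
  rcases ({a | S.restrict a = s} : Set (ι → β)).eq_empty_or_nonempty with h0 | ⟨c, hc⟩
  · have : S.restrict (π := fun _ : ι => β) ⁻¹' {s} = ∅ := h0
    rw [this, measure_empty, measure_empty]
  · have : S.restrict (π := fun _ : ι => β) ⁻¹' {s} = {a | ∀ x ∈ S, a x = c x} := by
      ext a
      have hc' : S.restrict c = s := hc
      simp [← hc', funext_iff]
    rw [this, h]

/-- By compactness, convergence of all cylinder probabilities implies weak convergence. -/
lemma exists_weaklyConverges [l.NeBot] {P : T → Measure (ι → β)}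
    (hP : ∀ t, IsProbabilityMeasure (P t))
    (h : ∀ (S : Finset ι) (c : ι → β), ∃ L,
      Tendsto (fun t => P t {a | ∀ x ∈ S, a x = c x}) l (𝓝 L)) :
    ∃ Q, WeaklyConverges l P Q := by
  let P' : T → ProbabilityMeasure (ι → β) := fun t => ⟨P t, hP t⟩
  choose L hL using h
  have hcl : ∀ Q : ProbabilityMeasure (ι → β), MapClusterPt Q l P' →
      ∀ S c, (Q : Measure (ι → β)) {a | ∀ x ∈ S, a x = c x} = L S c := by
    intro Q hQ S c
    have h1 : ContinuousAt (fun R : ProbabilityMeasure (ι → β) =>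
        (R : Measure (ι → β)) {a | ∀ x ∈ S, a x = c x}) Q :=
      ProbabilityMeasure.tendsto_measure_of_null_frontier_of_tendsto' tendsto_id
        (by simp [(isClopen_cylinder S c).frontier_eq])
    have h2 : MapClusterPt _ l _ := hQ.continuousAt_comp h1
    have h3 : ClusterPt _ (𝓝 (L S c)) := ClusterPt.mono h2 (hL S c)
    exact eq_of_nhds_neBot h3
  obtain ⟨Q, hQ⟩ := exists_clusterPt_of_compactSpace (Filter.map P' l)
  refine ⟨Q, hP, Q.2, ?_⟩
  refine le_nhds_of_unique_clusterPt fun R hR => ?_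
  have : IsProbabilityMeasure (R : Measure (ι → β)) := R.2
  have : IsProbabilityMeasure (Q : Measure (ι → β)) := Q.2
  have hRQ : (R : Measure (ι → β)) = Q := ext_of_cylinder fun S c =>
    (hcl R hR S c).trans (hcl Q hQ S c).symm
  exact Subtype.ext hRQ

lemma weaklyConverges_of_cylinder [l.NeBot] {P : T → Measure (ι → β)} {Q : Measure (ι → β)}
    (hP : ∀ t, IsProbabilityMeasure (P t)) [IsProbabilityMeasure Q]
    (h : ∀ (S : Finset ι) (c : ι → β), Tendsto (fun t => P t {a | ∀ x ∈ S, a x = c x}) l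
      (𝓝 (Q {a | ∀ x ∈ S, a x = c x}))) :
    WeaklyConverges l P Q := by
  obtain ⟨R, hP', hR, hlim⟩ := exists_weaklyConverges (l := l) hP fun S c => ⟨_, h S c⟩
  have : R = Q := ext_of_cylinder fun S c => tendsto_nhds_unique
    (ProbabilityMeasure.tendsto_measure_of_null_frontier_of_tendsto' hlim
        (by simp [(isClopen_cylinder S c).frontier_eq])) (h S c)
  subst this
  exact ⟨hP', hR, hlim⟩

/-- Weak convergence is inherited by the images under `F t`, if these are close to a limiting map
`F` in each coordinate with high probability, and if `F` is almost everywhere continuous. -/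
lemma weaklyConverges_map {ι' β' : Type*} [Countable ι'] [Finite β'] [MeasurableSpace β']
    [TopologicalSpace β'] [DiscreteTopology β'] [BorelSpace β'] [l.NeBot]
    {Ω : T → Type*} [∀ t, MeasurableSpace (Ω t)] [∀ t, DiscreteMeasurableSpace (Ω t)]
    {P : ∀ t, Measure (Ω t)} (hprob : ∀ t, IsProbabilityMeasure (P t))
    {e : ∀ t, Ω t → ι → β} {Q : Measure (ι → β)}
    (hPQ : WeaklyConverges l (fun t => (P t).map (e t)) Q)
    {f : ∀ t, Ω t → ι' → β'} {F : (ι → β) → ι' → β'} (hF : Measurable F)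
    (hclose : ∀ x, Tendsto (fun t => P t {ω | f t ω x ≠ F (e t ω) x}) l (𝓝 0))
    (hcont : ∀ x, ∀ᵐ a ∂Q, ∀ᶠ a' in 𝓝 a, F a' x = F a x) :
    WeaklyConverges l (fun t => (P t).map (f t)) (Q.map F) := by
  obtain ⟨hPe, hQ, hlim⟩ := hPQ
  have hmf : ∀ t, Measurable (f t) := fun t => Measurable.of_discrete
  have hme : ∀ t, Measurable (e t) := fun t => Measurable.of_discrete
  have : IsProbabilityMeasure (Q.map F) := Measure.isProbabilityMeasure_map hF.aemeasurable
  refine weaklyConverges_of_cylinder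
    (fun t => Measure.isProbabilityMeasure_map (hmf t).aemeasurable) fun S c => ?_
  have hC : MeasurableSet {a : ι' → β' | ∀ x ∈ S, a x = c x} :=
    (isClopen_cylinder S c).isOpen.measurableSet
  set A : Set (ι → β) := F ⁻¹' {a | ∀ x ∈ S, a x = c x} with hA
  have hAm : MeasurableSet A := hF hC
  have hfr : Q (frontier A) = 0 := by
    have h1 : ∀ᵐ a ∂Q, ∀ x ∈ S, ∀ᶠ a' in 𝓝 a, F a' x = F a x :=
      (ae_ball_iff S.countable_toSet).2 fun x _ => hcont x
    refine measure_mono_null ?_ (ae_iff.1 h1)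
    intro a ha hgood
    have h2 : ∀ᶠ a' in 𝓝 a, ∀ x ∈ S, F a' x = F a x := (Finset.eventually_all S).2 hgood
    have h3 : ∀ᶠ a' in 𝓝 a, (a' ∈ A ↔ a ∈ A) := by
      filter_upwards [h2] with a' ha'
      exact forall₂_congr fun x hx => by rw [ha' x hx]
    by_cases haA : a ∈ A
    · refine ha.2 (mem_interior_iff_mem_nhds.2 ?_)
      filter_upwards [h3] with a' ha' using ha'.2 haA
    · refine absurd ha.1 ?_
      rw [mem_closure_iff_frequently]
      exact not_frequently.2 (h3.mono fun a' ha' h => haA (ha'.1 h))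
  have hlim' : Tendsto (fun t => (P t).map (e t) A) l (𝓝 (Q A)) :=
    ProbabilityMeasure.tendsto_measure_of_null_frontier_of_tendsto' hlim hfr
  have hδ : Tendsto (fun t => ∑ x ∈ S, P t {ω | f t ω x ≠ F (e t ω) x}) l (𝓝 0) := by
    simpa using tendsto_finsetSum S fun x _ => hclose x
  rw [Measure.map_apply hF hC, ← hA]
  have hbad : ∀ t, P t {ω | ∃ x ∈ S, f t ω x ≠ F (e t ω) x} ≤
      ∑ x ∈ S, P t {ω | f t ω x ≠ F (e t ω) x} := fun t => by
    have : {ω | ∃ x ∈ S, f t ω x ≠ F (e t ω) x} = ⋃ x ∈ S, {ω | f t ω x ≠ F (e t ω) x} := by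
      ext ω
      simp
    rw [this]
    exact measure_biUnion_finset_le _ _
  refine tendsto_of_tendsto_of_tendsto_of_le_of_le
    (by simpa only [tsub_zero] using ENNReal.Tendsto.sub hlim' hδ (Or.inl (measure_ne_top Q A)))
    (by simpa only [add_zero] using hlim'.add hδ) (fun t => ?_) fun t => ?_
  · rw [Measure.map_apply (hmf t) hC]
    refine tsub_le_iff_right.2 ?_
    rw [Measure.map_apply (hme t) hAm]
    refine (measure_mono fun ω hω => ?_).trans
      ((measure_union_le _ _).trans (add_le_add_right (hbad t) _))
    by_cases h : ∃ x ∈ S, f t ω x ≠ F (e t ω) x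
    · exact Or.inr h
    · push Not at h
      exact Or.inl fun x hx => (h x hx).trans (hω x hx)
  · dsimp only
    rw [Measure.map_apply (hmf t) hC, Measure.map_apply (hme t) hAm]
    refine (measure_mono fun ω hω => ?_).trans
      ((measure_union_le _ _).trans (add_le_add_right (hbad t) _))
    by_cases h : ∃ x ∈ S, f t ω x ≠ F (e t ω) x
    · exact Or.inr h
    · push Not at h
      exact Or.inl fun x hx => (h x hx).symm.trans (hω x hx)

end WeakConvergence

/-! ### The arrow field in infinite volume -/

lemma eventually_apply_eq {d : ℕ} (a : ArrowField d) (x : Site d) : ∀ᶠ a' in 𝓝 a, a' x = a x := by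
  have h : ContinuousAt (fun a' : ArrowField d => a' x) a := (continuous_apply x).continuousAt
  rwa [ContinuousAt, nhds_discrete (Arrow d), tendsto_pure] at h

lemma eventually_iterate_eq {d : ℕ} (a : ArrowField d) (n : ℕ) (u : Option (Site d)) :
    ∀ᶠ a' in 𝓝 a, (step (next a'))^[n] u = (step (next a))^[n] u := by
  induction n with
  | zero => exact Eventually.of_forall fun _ => rfl
  | succ n ih =>
    simp only [Function.iterate_succ_apply']
    rcases h : (step (next a))^[n] u with _ | x
    · filter_upwards [ih] with a' ha'
      rw [ha', h]
      rfl
    · filter_upwards [ih, eventually_apply_eq a x] with a' ha' hx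
      rw [ha', h, step_some, step_some, next, next, hx]

/-- The depth is locally constant at rooted fields. -/
lemma eventually_depth_eq {d : ℕ} {a : ArrowField d} (ha : Rooted (next a)) (u : Option (Site d)) :
    ∀ᶠ a' in 𝓝 a, depth (next a') u = depth (next a) u := by
  obtain ⟨h1, h2⟩ := (depth_eq_iff (ha u) _).1 rfl
  have h3 : ∀ᶠ a' in 𝓝 a, ∀ j ∈ Finset.range (depth (next a) u + 1),
      (step (next a'))^[j] u = (step (next a))^[j] u :=
    (Finset.eventually_all _).2 fun j _ => eventually_iterate_eq a j u
  filter_upwards [h3] with a' ha'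
  have h4 : (step (next a'))^[depth (next a) u] u = none := (ha' _ (by simp)).trans h1
  refine (depth_eq_iff ⟨_, h4⟩ _).2 ⟨h4, fun j hj => ?_⟩
  rw [ha' j (by simp; omega)]
  exact h2 j hj

lemma isClopen_iterate {d : ℕ} (n : ℕ) (u : Option (Site d)) :
    IsClopen {a : ArrowField d | (step (next a))^[n] u = none} := by
  constructor
  · rw [← isOpen_compl_iff, isOpen_iff_mem_nhds]
    intro a ha
    filter_upwards [eventually_iterate_eq a n u] with a' ha'
    intro h
    exact ha (ha'.symm.trans h)
  · rw [isOpen_iff_mem_nhds]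
    intro a ha
    filter_upwards [eventually_iterate_eq a n u] with a' ha'
    exact ha'.trans ha

lemma measurable_depth {d : ℕ} (u : Option (Site d)) :
    Measurable fun a : ArrowField d => depth (next a) u := by
  have hm : ∀ n, MeasurableSet {a : ArrowField d | (step (next a))^[n] u = none} := fun n =>
    (isClopen_iterate n u).isOpen.measurableSet
  have hfin : MeasurableSet {a : ArrowField d | ∃ n, (step (next a))^[n] u = none} := by
    simpa only [Set.ofPred_exists] using MeasurableSet.iUnion hm
  refine measurable_to_countable' fun k => ?_
  have : (fun a : ArrowField d => depth (next a) u) ⁻¹' {k} =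
      ({a | (step (next a))^[k] u = none} ∩
        ⋂ j ∈ Finset.range k, {a | (step (next a))^[j] u = none}ᶜ) ∪
      ({a | ∃ n, (step (next a))^[n] u = none}ᶜ ∩ {_a | k = 0}) := by
    ext a
    by_cases h : ∃ n, (step (next a))^[n] u = none
    · simpa [h] using depth_eq_iff h k
    · have h0 : depth (next a) u = 0 := by
        rw [depth, Nat.sInf_eq_zero]
        right
        ext n
        simpa using fun hn => h ⟨n, hn⟩
      push Not at h
      simp [h, h0, eq_comm]
  rw [this]
  exact ((hm k).inter (Finset.measurableSet_biInter _ fun j _ => (hm j).compl)).union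
    (hfin.compl.inter (MeasurableSet.const _))

lemma measurableSet_rooted (d : ℕ) : MeasurableSet {a : ArrowField d | Rooted (next a)} := by
  simp only [Rooted, Set.ofPred_forall, Set.ofPred_exists]
  exact MeasurableSet.iInter fun u => MeasurableSet.iUnion fun n =>
    (isClopen_iterate n u).isOpen.measurableSet

/-- The arrow fields converge in law, and the limit is rooted because the tails of the path
lengths are uniformly small. -/
theorem exists_fieldLimit {d : ℕ} {γ : ℝ} (hγ : 0 < γ) : ∃ Q : Measure (ArrowField d),
    WeaklyConverges atTop (fun Λ => (fieldMeasure γ Λ).map (extendNone Λ)) Q ∧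
      ∀ᵐ a ∂Q, Rooted (next a) := by
  have hprob := fun Λ : Finset (Site d) => isProbabilityMeasure_fieldMeasure hγ Λ
  have hme : ∀ Λ : Finset (Site d), Measurable (extendNone Λ) := fun Λ => Measurable.of_discrete
  obtain ⟨Q, hQ⟩ := exists_weaklyConverges (l := (atTop : Filter (Finset (Site d))))
    (P := fun Λ => (fieldMeasure γ Λ).map (extendNone Λ))
    (fun Λ => Measure.isProbabilityMeasure_map (hme Λ).aemeasurable) fun S c => by
      obtain ⟨L, hL⟩ := exists_tendsto_cylinder hγ S c
      refine ⟨L, hL.congr fun Λ => ?_⟩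
      rw [Measure.map_apply (hme Λ) (isClopen_cylinder S c).isOpen.measurableSet]
      rfl
  refine ⟨Q, hQ, ?_⟩
  obtain ⟨hP, hQp, hlim⟩ := hQ
  have hbound : ∀ x N, Q {a | (step (next a))^[N] (some x) ≠ none} ≤
      ENNReal.ofReal ((2 * d / (2 * d + γ)) ^ N) := by
    intro x N
    have hcl := (isClopen_iterate N (some x)).compl
    have h1 := ProbabilityMeasure.tendsto_measure_of_null_frontier_of_tendsto' hlim
      (E := {a | (step (next a))^[N] (some x) = none}ᶜ) (by simp [hcl.frontier_eq])
    refine le_of_tendsto h1 (Eventually.of_forall fun Λ => ?_)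
    refine le_trans (le_of_eq ?_) (fieldMeasure_longPath_le hγ Λ x N)
    exact Measure.map_apply (hme Λ) hcl.isOpen.measurableSet
  have hx : ∀ x, ∀ᵐ a ∂Q, ∃ n, (step (next a))^[n] (some x) = none := by
    intro x
    rw [ae_iff]
    refine le_antisymm (ge_of_tendsto (tendsto_tail hγ (d := d))
      (Eventually.of_forall fun N => ?_)) zero_le
    refine (measure_mono fun a ha => ?_).trans (hbound x N)
    exact fun h => ha ⟨N, h⟩
  filter_upwards [ae_all_iff.2 hx] with a ha
  rintro (_ | x)
  · exact ⟨0, rfl⟩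
  · exact ha x

/-! ### Heights of arrow fields -/

/-- The set of directions of the neighbours that are closer to the root by exactly one, for a site
at depth `k` whose neighbours have depths `D`. -/
def parentDirs {d : ℕ} (k : ℕ) (D : Dir d → ℕ) : Set (Site d) :=
  {y | ∃ h : len y = 1, D ⟨y, h⟩ + 1 = k}

/-- The set of directions of the neighbours that are closer to the root. -/
def closerDirs {d : ℕ} (k : ℕ) (D : Dir d → ℕ) : Set (Site d) :=
  {y | ∃ h : len y = 1, D ⟨y, h⟩ < k}

/-- The height at a site with arrow `c` and depth `k` whose neighbours have depths `D`. -/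
def localHeight {d : ℕ} (α : Set (Site d) → Set ℕ → Site d → ℕ) (c : Arrow d) (k : ℕ)
    (D : Dir d → ℕ) : Fin (2 * d + 1) :=
  match c with
  | none => Fin.last (2 * d)
  | some e => ⟨min (α (parentDirs k D) (Set.Ico (2 * d - (closerDirs k D).ncard)
      (2 * d - (closerDirs k D).ncard + (parentDirs k D).ncard)) e.1) (2 * d), by omega⟩

/-- The heights of an arrow field on the lattice. -/
def heights {d : ℕ} (α : Set (Site d) → Set ℕ → Site d → ℕ) (a : ArrowField d) : Heights d :=
  fun x => localHeight α (a x) (depth (next a) (some x)) fun e => depth (next a) (some (x + e.1))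

/-- The heights of an arrow field on `Λ`; sites outside `Λ` have depth zero. -/
def heightsOn {d : ℕ} (α : Set (Site d) → Set ℕ → Site d → ℕ) (Λ : Finset (Site d))
    (b : Λ → Arrow d) (x : Λ) : Fin (2 * d + 1) :=
  localHeight α (b x) (depth (nextIn Λ b) (some x))
    fun e => depth (nextIn Λ b) (collapse Λ (some (x.1 + e.1)))

lemma measurable_heights {d : ℕ} (α : Set (Site d) → Set ℕ → Site d → ℕ) :
    Measurable (heights α) := by
  refine measurable_pi_iff.2 fun x => ?_
  have h1 : Measurable fun a : ArrowField d => ((a x, depth (next a) (some x)),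
      fun e : Dir d => depth (next a) (some (x + e.1))) :=
    ((measurable_pi_apply x).prodMk (measurable_depth _)).prodMk
      (measurable_pi_iff.2 fun e => measurable_depth _)
  have h2 : Measurable fun p : (Arrow d × ℕ) × (Dir d → ℕ) => localHeight α p.1.1 p.1.2 p.2 :=
    Measurable.of_discrete
  exact h2.comp h1

lemma eventually_heights_eq {d : ℕ} (α : Set (Site d) → Set ℕ → Site d → ℕ) {a : ArrowField d}
    (ha : Rooted (next a)) (x : Site d) : ∀ᶠ a' in 𝓝 a, heights α a' x = heights α a x := by
  have h : ∀ᶠ a' in 𝓝 a, ∀ e : Dir d,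
      depth (next a') (some (x + e.1)) = depth (next a) (some (x + e.1)) :=
    eventually_all.2 fun e => eventually_depth_eq ha _
  filter_upwards [eventually_apply_eq a x, eventually_depth_eq ha (some x), h] with a' h1 h2 h3
  simp only [heights, h1, h2, h3]

/-- The ball of radius `n` about `x`. -/
def ball {d : ℕ} : ℕ → Site d → Finset (Site d)
  | 0, x => {x}
  | n + 1, x => insert x (Finset.univ.biUnion fun e : Dir d => ball n (x + e.1))

lemma self_mem_ball {d : ℕ} (n : ℕ) (x : Site d) : x ∈ ball n x := by
  cases n <;> simp [ball]

/-- Paths that start well inside `Λ` do not notice the boundary. -/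
lemma iterate_nextIn_eq_none_iff {d : ℕ} {Λ : Finset (Site d)} (b : Λ → Arrow d) (n : ℕ) :
    ∀ x, ball n x ⊆ Λ → ∀ j ≤ n, ((step (nextIn Λ b))^[j] (collapse Λ (some x)) = none ↔
      (step (next (extendNone Λ b)))^[j] (some x) = none) := by
  induction n with
  | zero =>
    intro x hx j hj
    have hxΛ : x ∈ Λ := hx (self_mem_ball 0 x)
    obtain rfl : j = 0 := by omega
    simp [collapse, hxΛ]
  | succ n ih =>
    intro x hx j hj
    have hxΛ : x ∈ Λ := hx (self_mem_ball _ x)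
    have h1 : collapse Λ (some x) = some ⟨x, hxΛ⟩ := dif_pos hxΛ
    rcases j with _ | j
    · simp [h1]
    · rw [h1, Function.iterate_succ_apply, Function.iterate_succ_apply, step_some, step_some, next,
        extendNone_of_mem b hxΛ, nextIn]
      rcases b ⟨x, hxΛ⟩ with _ | e
      · simp [target, collapse]
      · refine ih (x + e.1) (fun y hy => hx ?_) j (by omega)
        exact Finset.mem_insert_of_mem (Finset.mem_biUnion.2 ⟨e, Finset.mem_univ _, hy⟩)

lemma depth_nextIn_eq {d : ℕ} {Λ : Finset (Site d)} (b : Λ → Arrow d) {N : ℕ} {x : Site d}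
    (hx : ball N x ⊆ Λ) (hN : (step (next (extendNone Λ b)))^[N] (some x) = none) :
    depth (nextIn Λ b) (collapse Λ (some x)) = depth (next (extendNone Λ b)) (some x) := by
  have key := iterate_nextIn_eq_none_iff b N x hx
  have hle : depth (next (extendNone Λ b)) (some x) ≤ N := Nat.sInf_le hN
  obtain ⟨h1, h2⟩ := (depth_eq_iff ⟨N, hN⟩ _).1 rfl
  refine (depth_eq_iff ⟨N, (key N le_rfl).2 hN⟩ _).2 ⟨(key _ hle).2 h1, fun j hj => ?_⟩
  exact fun h => h2 j hj ((key j (by omega)).1 h)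

/-- The laws of the heights in finite volume converge to the law of the heights of the limiting
arrow field. -/
theorem weaklyConverges_heights {d : ℕ} {γ : ℝ} (hγ : 0 < γ) {Q : Measure (ArrowField d)}
    (hQ : WeaklyConverges atTop (fun Λ => (fieldMeasure γ Λ).map (extendNone Λ)) Q)
    (hroot : ∀ᵐ a ∂Q, Rooted (next a)) (α : Set (Site d) → Set ℕ → Site d → ℕ) :
    WeaklyConverges atTop
      (fun Λ => (fieldMeasure γ Λ).map fun b => extendZero d Λ (heightsOn α Λ b))
      (Q.map (heights α)) := by
  refine weaklyConverges_map (fun Λ => isProbabilityMeasure_fieldMeasure hγ Λ) hQ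
    (measurable_heights α) (fun x => ?_)
    (fun x => hroot.mono fun a ha => eventually_heights_eq α ha x)
  -- the depths of `x` and its neighbours agree as soon as their paths have at most `N` steps
  have hbound : ∀ N, ∀ᶠ Λ : Finset (Site d) in atTop,
      fieldMeasure γ Λ {b | extendZero d Λ (heightsOn α Λ b) x ≠ heights α (extendNone Λ b) x} ≤
        (2 * d + 1 : ℕ) * ENNReal.ofReal ((2 * d / (2 * d + γ)) ^ N) := by
    intro N
    filter_upwards [eventually_ge_atTop (ball (N + 1) x ∪ ball N x)] with Λ hΛ
    have hxΛ : x ∈ Λ := hΛ (Finset.mem_union_right _ (self_mem_ball N x))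
    have hx : ball N x ⊆ Λ := Finset.union_subset_right hΛ
    have hy : ∀ e : Dir d, ball N (x + e.1) ⊆ Λ := fun e y hy =>
      Finset.union_subset_left hΛ
        (Finset.mem_insert_of_mem (Finset.mem_biUnion.2 ⟨e, Finset.mem_univ _, hy⟩))
    let site : Arrow d → Site d := fun c => c.elim x fun e => x + e.1
    have hsub : {b | extendZero d Λ (heightsOn α Λ b) x ≠ heights α (extendNone Λ b) x} ⊆
        ⋃ c : Arrow d, {b | (step (next (extendNone Λ b)))^[N] (some (site c)) ≠ none} := by
      intro b hb
      by_contra hcon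
      simp only [Set.mem_iUnion, Set.mem_ofPred_eq, not_exists, not_not] at hcon
      refine hb ?_
      have h0 := depth_nextIn_eq b hx (hcon none)
      have h1 : ∀ e : Dir d, _ := fun e => depth_nextIn_eq b (hy e) (hcon (some e))
      have h2 : collapse Λ (some x) = some ⟨x, hxΛ⟩ := dif_pos hxΛ
      rw [h2] at h0
      simp only [extendZero, hxΛ, dif_pos, heightsOn, heights, h0, h1, extendNone_of_mem b hxΛ]
    refine (measure_mono hsub).trans ((measure_iUnion_fintype_le _ _).trans ?_)
    refine (Finset.sum_le_sum fun c _ => fieldMeasure_longPath_le hγ Λ (site c) N).trans ?_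
    simp [card_dir]
  rw [ENNReal.tendsto_nhds_zero]
  intro ε hε
  have h1 : Tendsto (fun N : ℕ => ((2 * d + 1 : ℕ) : ENNReal) *
      ENNReal.ofReal ((2 * d / (2 * d + γ)) ^ N)) atTop (𝓝 0) := by
    simpa using ENNReal.Tendsto.const_mul (tendsto_tail hγ (d := d))
      (Or.inr (ENNReal.natCast_ne_top (2 * d + 1)))
  obtain ⟨N, hN⟩ := (ENNReal.tendsto_nhds_zero.1 h1 ε hε).exists
  filter_upwards [hbound N] with Λ hΛ using hΛ.trans hN

/-! ### Trees of arrow fields -/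

open Classical in
/-- The edge configuration of an arrow field on the lattice. -/
def treeOf {d : ℕ} (a : ArrowField d) : EdgeConfig d :=
  fun e => decide (∃ x, e.1 = s(some x, next a x))

open Classical in
/-- The edge configuration of an arrow field on `Λ`. -/
def treeOn {d : ℕ} (Λ : Finset (Site d)) (b : Λ → Arrow d) : EdgeConfig d :=
  fun e => decide (∃ x : Λ, e.1 = s(some x.1, target x.1 (b x)))

lemma exists_sites_of_edge {d : ℕ} (e : Sym2 (Option (Site d))) :
    ∃ S : Finset (Site d), ∀ x, some x ∈ e → x ∈ S := by
  classical
  induction e with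
  | _ u v =>
    refine ⟨u.toFinset ∪ v.toFinset, fun x hx => ?_⟩
    rcases Sym2.mem_iff.1 hx with h | h
    · simp [← h]
    · simp [← h]

lemma eventually_treeOf_eq {d : ℕ} (a : ArrowField d) (e : Edge d) :
    ∀ᶠ a' in 𝓝 a, treeOf a' e = treeOf a e := by
  obtain ⟨S, hS⟩ := exists_sites_of_edge e.1
  filter_upwards [(Finset.eventually_all S).2 fun x _ => eventually_apply_eq a x] with a' ha'
  simp only [treeOf, decide_eq_decide]
  refine exists_congr fun x => ?_
  by_cases hx : x ∈ S
  · rw [next, next, ha' x hx]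
  · have hne : ∀ v, e.1 ≠ s(some x, v) := fun v h =>
      hx (hS x (by rw [h]; exact Sym2.mem_mk_left _ _))
    simp [hne]

lemma measurable_treeOf (d : ℕ) : Measurable (treeOf (d := d)) := by
  have : Continuous (treeOf (d := d)) := continuous_pi fun e =>
    continuous_iff_continuousAt.2 fun a =>
      (tendsto_pure.2 (eventually_treeOf_eq a e)).mono_right (pure_le_nhds _)
  exact this.measurable

theorem weaklyConverges_treeOn {d : ℕ} {γ : ℝ} (hγ : 0 < γ) {Q : Measure (ArrowField d)}
    (hQ : WeaklyConverges atTop (fun Λ => (fieldMeasure γ Λ).map (extendNone Λ)) Q) :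
    WeaklyConverges atTop (fun Λ => (fieldMeasure γ Λ).map (treeOn Λ)) (Q.map treeOf) := by
  refine weaklyConverges_map (fun Λ => isProbabilityMeasure_fieldMeasure hγ Λ) hQ
    (measurable_treeOf d) (fun e => ?_) (fun e => ae_of_all _ fun a => eventually_treeOf_eq a e)
  obtain ⟨S, hS⟩ := exists_sites_of_edge e.1
  refine tendsto_const_nhds.congr' ?_
  filter_upwards [eventually_ge_atTop S] with Λ hΛ
  refine (measure_mono_null ?_ measure_empty).symm
  intro b hb
  refine hb ?_
  simp only [treeOf, treeOn, decide_eq_decide]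
  constructor
  · rintro ⟨x, hx⟩
    exact ⟨x.1, by rw [hx, next, extendNone_of_mem b x.2]⟩
  · rintro ⟨x, hx⟩
    have hxΛ : x ∈ Λ := hΛ (hS x (by rw [hx]; exact Sym2.mem_mk_left _ _))
    exact ⟨⟨x, hxΛ⟩, by rw [hx, next, extendNone_of_mem b hxΛ]⟩

/-! ### Spanning trees and rooted fields -/

lemma adj_target {d : ℕ} (x : Site d) (c : Arrow d) : (G d).Adj (some x) (target x c) := by
  rcases c with _ | e
  · exact trivial
  · change len (x - (x + e.1)) = 1
    rw [sub_add_cancel_left, len_neg]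
    exact e.2

lemma exists_target_of_adj {d : ℕ} {x : Site d} {u : Option (Site d)} (h : (G d).Adj (some x) u) :
    ∃ c, u = target x c := by
  rcases u with _ | y
  · exact ⟨none, rfl⟩
  · have h' : len (x - y) = 1 := h
    refine ⟨some ⟨y - x, by rw [← neg_sub, len_neg, h']⟩, ?_⟩
    simp [target]

lemma target_injective {d : ℕ} (x : Site d) : Function.Injective (target x) :=
  Option.map_injective fun _ _ h => Subtype.ext (add_left_cancel h)

/-- The edge of the arrow `c` at `x`. -/
def arrowEdge {d : ℕ} (x : Site d) (c : Arrow d) : Edge d := ⟨s(some x, target x c), adj_target x c⟩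

lemma treeOn_eq_true {d : ℕ} {Λ : Finset (Site d)} {b : Λ → Arrow d} {e : Edge d} :
    treeOn Λ b e = true ↔ ∃ x : Λ, e = arrowEdge x.1 (b x) := by
  simp [treeOn, arrowEdge, Subtype.ext_iff]

lemma treeOf_eq_true {d : ℕ} {a : ArrowField d} {e : Edge d} :
    treeOf a e = true ↔ ∃ x, e = arrowEdge x (a x) := by
  classical
  rw [treeOf, decide_eq_true_iff]
  exact exists_congr fun x => ⟨fun h => Subtype.ext h, fun h => congrArg Subtype.val h⟩

lemma openGraph_treeOf {d : ℕ} (a : ArrowField d) :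
    openGraph (treeOf a) = parentGraph (next a) := by
  unfold openGraph parentGraph
  congr 1
  ext e
  constructor
  · rintro ⟨h, he⟩
    obtain ⟨x, hx⟩ := treeOf_eq_true.1 he
    exact ⟨x, (congrArg Subtype.val hx).symm⟩
  · rintro ⟨x, rfl⟩
    exact ⟨adj_target x (a x), treeOf_eq_true.2 ⟨x, rfl⟩⟩

lemma distToRoot_treeOf {d : ℕ} {a : ArrowField d} (ha : Rooted (next a)) (x : Site d) :
    distToRoot (treeOf a) x = depth (next a) (some x) := by
  rw [distToRoot, openGraph_treeOf, parentGraph_dist ha]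

lemma rootPath_treeOf_snd {d : ℕ} {a : ArrowField d} (ha : Rooted (next a))
    (h : (openGraph (treeOf a)).IsTree) (x : Site d) :
    (rootPath (treeOf a) h x).snd = target x (a x) := by
  have key : ∀ (H : SimpleGraph (Option (Site d))), H = parentGraph (next a) →
      ∀ p : H.Walk (some x) none, p.IsPath → p.snd = target x (a x) := by
    rintro _ rfl p hp
    exact parentGraph_path_snd ha hp
  exact key _ (openGraph_treeOf a) _ (h.existsUnique_path (some x) none).choose_spec.1

/-- The heights assigned to a tree are those of the arrow field that generates it. -/
theorem phi_treeOf {d : ℕ} (α : Set (Site d) → Set ℕ → Site d → ℕ) {a : ArrowField d}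
    (ha : Rooted (next a)) : phi d α (treeOf a) = heights α a := by
  have htree : (openGraph (treeOf a)).IsTree := by
    rw [openGraph_treeOf]
    exact parentGraph_isTree ha
  funext x
  have hP : PData (treeOf a) x = parentDirs (depth (next a) (some x))
      fun e => depth (next a) (some (x + e.1)) := by
    ext y
    simp [PData, parentDirs, distToRoot_treeOf ha]
  have hn : nData (treeOf a) x = (closerDirs (depth (next a) (some x))
      fun e => depth (next a) (some (x + e.1))).ncard := by
    rw [nData]
    congr 1
    ext y
    simp [closerDirs, distToRoot_treeOf ha]
  simp only [phi, dif_pos htree, rootPath_treeOf_snd ha, heights, KData, hP, hn]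
  rcases a x with _ | e
  · rfl
  · simp [target, localHeight]

lemma collapse_some {d : ℕ} {Λ : Finset (Site d)} (x : Λ) : collapse Λ (some x.1) = some x :=
  dif_pos x.2

lemma ends_arrowEdge {d : ℕ} {Λ : Finset (Site d)} (b : Λ → Arrow d) (x : Λ) :
    ends Λ (arrowEdge x.1 (b x)) = s(some x, nextIn Λ b x) := by
  rw [ends, arrowEdge, Sym2.map_mk, collapse_some]
  rfl

lemma fromEdgeSet_ends_treeOn {d : ℕ} {Λ : Finset (Site d)} (b : Λ → Arrow d) :
    SimpleGraph.fromEdgeSet (ends Λ '' {e | treeOn Λ b e = true}) =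
      parentGraph (nextIn Λ b) := by
  unfold parentGraph
  congr 1
  ext e
  constructor
  · rintro ⟨e', he', rfl⟩
    obtain ⟨x, rfl⟩ := treeOn_eq_true.1 he'
    exact ⟨x, (ends_arrowEdge b x).symm⟩
  · rintro ⟨x, rfl⟩
    exact ⟨arrowEdge x.1 (b x), treeOn_eq_true.2 ⟨x, rfl⟩, ends_arrowEdge b x⟩

lemma nextIn_ne_some {d : ℕ} {Λ : Finset (Site d)} {b : Λ → Arrow d} (hb : Rooted (nextIn Λ b))
    {x y : Λ} (hx : nextIn Λ b x = some y) (hy : nextIn Λ b y = some x) : False := by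
  have h1 := depth_some hb x
  have h2 := depth_some hb y
  rw [hx] at h1
  rw [hy] at h2
  omega

lemma treeOn_mem_spanningTrees {d : ℕ} {Λ : Finset (Site d)} {b : Λ → Arrow d}
    (hb : Rooted (nextIn Λ b)) : treeOn Λ b ∈ spanningTrees d Λ := by
  refine ⟨fun e he => ?_, fun e he e' he' h => ?_, ?_⟩
  · obtain ⟨x, rfl⟩ := treeOn_eq_true.1 he
    rw [ends_arrowEdge, Sym2.mk_isDiag_iff]
    exact fun h => nextIn_ne_some hb h.symm h.symm
  · obtain ⟨x, rfl⟩ := treeOn_eq_true.1 he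
    obtain ⟨y, rfl⟩ := treeOn_eq_true.1 he'
    rw [ends_arrowEdge, ends_arrowEdge, Sym2.eq_iff] at h
    rcases h with ⟨h, -⟩ | ⟨h1, h2⟩
    · rw [Option.some_injective _ h]
    · exact (nextIn_ne_some hb h2 h1.symm).elim
  · rw [fromEdgeSet_ends_treeOn]
    exact parentGraph_isTree hb

lemma treeOn_injective {d : ℕ} {Λ : Finset (Site d)} {b b' : Λ → Arrow d}
    (hb : Rooted (nextIn Λ b)) (hb' : Rooted (nextIn Λ b')) (h : treeOn Λ b = treeOn Λ b') :
    b = b' := by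
  have hg : parentGraph (nextIn Λ b) = parentGraph (nextIn Λ b') := by
    rw [← fromEdgeSet_ends_treeOn, ← fromEdgeSet_ends_treeOn, h]
  have hD : ∀ u, depth (nextIn Λ b) u = depth (nextIn Λ b') u := fun u => by
    rw [← parentGraph_dist hb, ← parentGraph_dist hb', hg]
  funext x
  have h1 : treeOn Λ b' (arrowEdge x.1 (b x)) = true := h ▸ treeOn_eq_true.2 ⟨x, rfl⟩
  obtain ⟨y, hy⟩ := treeOn_eq_true.1 h1
  have hy' := congrArg Subtype.val hy
  simp only [arrowEdge, Sym2.eq_iff] at hy'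
  rcases hy' with ⟨h2, h3⟩ | ⟨h2, h3⟩
  · obtain rfl : x = y := Subtype.ext (Option.some_injective _ h2)
    exact target_injective _ h3
  · have h4 : nextIn Λ b x = some y := by rw [nextIn, h3, collapse_some]
    have h5 : nextIn Λ b' y = some x := by rw [nextIn, ← h2, collapse_some]
    have h6 := depth_some hb x
    have h7 := depth_some hb' y
    rw [h4] at h6
    rw [h5, ← hD, ← hD] at h7
    omega

/-- Every spanning tree arises from the arrows that point to the neighbour closer to the root. -/
lemma exists_treeOn_eq {d : ℕ} {Λ : Finset (Site d)} {t : EdgeConfig d}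
    (ht : t ∈ spanningTrees d Λ) : ∃ b, Rooted (nextIn Λ b) ∧ treeOn Λ b = t := by
  obtain ⟨hdiag, hinj, htree⟩ := ht
  set K := SimpleGraph.fromEdgeSet (ends Λ '' {e | t e = true}) with hK
  have hex : ∀ x : Λ, ∃ c : Arrow d, t (arrowEdge x.1 c) = true ∧
      K.Adj (some x) (collapse Λ (target x.1 c)) ∧
      K.dist (some x) none = K.dist (collapse Λ (target x.1 c)) none + 1 := by
    intro x
    obtain ⟨v, hadj, hdist⟩ : ∃ v, K.Adj (some x) v ∧
        K.dist (some x) none = K.dist v none + 1 := by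
      obtain ⟨p, hp⟩ := htree.connected.exists_walk_length_eq_dist (some x) none
      cases p with
      | @cons _ v _ h q =>
        refine ⟨v, h, le_antisymm ?_ ?_⟩
        · obtain ⟨r, hr⟩ := htree.connected.exists_walk_length_eq_dist v none
          rw [← hr]
          exact SimpleGraph.dist_le (SimpleGraph.Walk.cons h r)
        · rw [← hp, SimpleGraph.Walk.length_cons]
          exact Nat.succ_le_succ (SimpleGraph.dist_le q)
    obtain ⟨⟨⟨e, he⟩, hte, hends⟩, -⟩ := (SimpleGraph.fromEdgeSet_adj _).1 hadj
    have key : ∃ u, e = s(some x.1, u) ∧ collapse Λ u = v := by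
      induction e with
      | _ u₁ u₂ =>
        have hc : ∀ u, collapse Λ u = some x → u = some x.1 := by
          rintro (_ | y) hy
          · simp [collapse] at hy
          · by_cases hyΛ : y ∈ Λ
            · simp only [collapse, dif_pos hyΛ, Option.some.injEq] at hy
              rw [← hy]
            · simp [collapse, hyΛ] at hy
        simp only [ends, Sym2.map_mk, Sym2.eq_iff] at hends
        rcases hends with ⟨h1, h2⟩ | ⟨h1, h2⟩
        · exact ⟨u₂, by rw [hc _ h1], h2⟩
        · exact ⟨u₁, by rw [hc _ h2, Sym2.eq_swap], h1⟩
    obtain ⟨u, rfl, rfl⟩ := key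
    obtain ⟨c, rfl⟩ := exists_target_of_adj he
    exact ⟨c, hte, hadj, hdist⟩
  choose b hbt hbadj hbdist using hex
  obtain ⟨hr, hKeq⟩ := eq_parentGraph_of_isTree (f := nextIn Λ b) htree hbadj hbdist
  refine ⟨b, hr, funext fun e => Bool.eq_iff_iff.2 ⟨fun he => ?_, fun he => ?_⟩⟩
  · obtain ⟨x, rfl⟩ := treeOn_eq_true.1 he
    exact hbt x
  · refine treeOn_eq_true.2 ?_
    have h1 : ends Λ e ∈ K.edgeSet := by
      rw [hK, SimpleGraph.edgeSet_fromEdgeSet]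
      exact ⟨⟨e, he, rfl⟩, hdiag e he⟩
    rw [hKeq, parentGraph, SimpleGraph.edgeSet_fromEdgeSet] at h1
    obtain ⟨⟨x, hx⟩, -⟩ := h1
    exact ⟨x, hinj he (hbt x) (by rw [ends_arrowEdge]; exact hx.symm)⟩

lemma fieldWeight_eq_pow_numDiss {d : ℕ} (γ : ℝ) {Λ : Finset (Site d)} (b : Λ → Arrow d) :
    fieldWeight γ b = γ ^ numDiss (treeOn Λ b) := by
  classical
  have h1 : {e : Edge d | treeOn Λ b e = true ∧ none ∈ e.1} =
      (fun x : Λ => arrowEdge x.1 none) '' (Finset.univ.filter fun x : Λ => b x = none) := by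
    ext e
    constructor
    · rintro ⟨he, hn⟩
      obtain ⟨x, rfl⟩ := treeOn_eq_true.1 he
      have hb : b x = none := by
        rcases hbx : b x with _ | y
        · rfl
        · rw [hbx] at hn
          simp [arrowEdge, target] at hn
      exact ⟨x, by simpa using hb, by rw [hb]⟩
    · rintro ⟨x, hx, rfl⟩
      have hb : b x = none := by simpa using hx
      exact ⟨treeOn_eq_true.2 ⟨x, by rw [hb]⟩, by simp [arrowEdge, target]⟩
  have hinj : Function.Injective fun x : Λ => (arrowEdge x.1 none : Edge d) := by
    intro x y h
    have := congrArg Subtype.val h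
    simp only [arrowEdge, target, Option.map_none, Sym2.eq_iff] at this
    rcases this with ⟨h, -⟩ | ⟨h, -⟩
    · exact Subtype.ext (Option.some_injective _ h)
    · simp at h
  rw [numDiss, h1, Set.ncard_image_of_injective _ hinj, Set.ncard_coe_finset]
  have h2 : ∀ x, arrowWeight γ (b x) = if b x = none then γ else 1 := fun x => by
    rcases b x with _ | y <;> simp [arrowWeight]
  simp only [fieldWeight, h2]
  rw [Finset.prod_ite, Finset.prod_const, Finset.prod_const_one, mul_one]

lemma fieldSum_map {d : ℕ} {γ : ℝ} {Λ : Finset (Site d)} {X : Type*} [MeasurableSpace X]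
    (f : (Λ → Arrow d) → X) : (fieldSum γ Λ).map f =
      ∑ b ∈ rootedFields Λ, ENNReal.ofReal (fieldWeight γ b) • Measure.dirac (f b) := by
  have hf : Measurable f := Measurable.of_discrete
  rw [fieldSum, ← Measure.mapₗ_apply_of_measurable hf, map_sum]
  refine Finset.sum_congr rfl fun b _ => ?_
  rw [map_smul, Measure.mapₗ_apply_of_measurable hf, Measure.map_dirac' hf]

lemma treeWeight_eq_map {d : ℕ} (γ : ℝ) (Λ : Finset (Site d)) :
    treeWeight d γ Λ = (fieldSum γ Λ).map (treeOn Λ) := by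
  have hbij : Function.Bijective fun b : rootedFields Λ =>
      (⟨treeOn Λ b.1, treeOn_mem_spanningTrees (mem_rootedFields.1 b.2)⟩ : spanningTrees d Λ) := by
    constructor
    · intro b b' h
      exact Subtype.ext (treeOn_injective (mem_rootedFields.1 b.2) (mem_rootedFields.1 b'.2)
        (congrArg Subtype.val h))
    · rintro ⟨t, ht⟩
      obtain ⟨b, hb, rfl⟩ := exists_treeOn_eq ht
      exact ⟨⟨b, mem_rootedFields.2 hb⟩, rfl⟩
  rw [fieldSum_map]
  ext s hs
  rw [treeWeight, Measure.sum_apply _ hs, ← (Equiv.ofBijective _ hbij).tsum_eq, tsum_fintype,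
    Measure.coe_finsetSum, Finset.sum_apply, ← Finset.sum_coe_sort (rootedFields Λ)]
  refine Finset.sum_congr rfl fun b _ => ?_
  rw [fieldWeight_eq_pow_numDiss]
  rfl

theorem muMeasure_eq_map {d : ℕ} (γ : ℝ) (Λ : Finset (Site d)) :
    muMeasure d γ Λ = (fieldMeasure γ Λ).map (treeOn Λ) := by
  have hm : Measurable (treeOn Λ) := Measurable.of_discrete
  rw [muMeasure, treeWeight_eq_map, fieldMeasure, Measure.map_smul, Measure.map_apply hm .univ,
    Set.preimage_univ]

/-! ### Recurrent configurations -/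

/-- The number of neighbours of `x` in `W`. -/
def degIn {d : ℕ} {Λ : Finset (Site d)} (W : Finset Λ) (x : Λ) : ℕ :=
  (W.filter fun z => len (x.1 - z.1) = 1).card

open Classical in
lemma degIn_eq_card_dir {d : ℕ} {Λ : Finset (Site d)} (W : Finset Λ) (x : Λ) :
    degIn W x = (Finset.univ.filter fun e : Dir d => ∃ z ∈ W, z.1 = x.1 + e.1).card := by
  symm
  refine Finset.card_bij' (fun e he => (Finset.mem_filter.1 he).2.choose)
    (fun z hz => ⟨z.1 - x.1, by rw [← neg_sub, len_neg]; exact (Finset.mem_filter.1 hz).2⟩)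
    (fun e he => ?_) (fun z hz => ?_) (fun e he => ?_) fun z hz => ?_
  · have h := (Finset.mem_filter.1 he).2.choose_spec
    refine Finset.mem_filter.2 ⟨h.1, ?_⟩
    rw [h.2, sub_add_cancel_left, len_neg]
    exact e.2
  · exact Finset.mem_filter.2 ⟨Finset.mem_univ _, z, (Finset.mem_filter.1 hz).1, by simp⟩
  · have h := (Finset.mem_filter.1 he).2.choose_spec
    refine Subtype.ext ?_
    dsimp only
    rw [h.2, add_sub_cancel_left]
  · generalize_proofs _ h
    refine Subtype.ext ?_
    rw [h.choose_spec.2, add_sub_cancel]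

lemma degIn_le {d : ℕ} {Λ : Finset (Site d)} (W : Finset Λ) (x : Λ) : degIn W x ≤ 2 * d := by
  classical
  rw [degIn_eq_card_dir, ← card_dir d]
  exact Finset.card_le_univ _

lemma len_sub_comm {d : ℕ} (x y : Site d) : len (x - y) = len (y - x) := by
  rw [← neg_sub, len_neg]

open Classical in
lemma degIn_eq_erase {d : ℕ} {Λ : Finset (Site d)} {W : Finset Λ} (x : Λ) {z : Λ} (hz : z ∈ W) :
    degIn W x = degIn (W.erase z) x + if len (x.1 - z.1) = 1 then 1 else 0 := by
  unfold degIn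
  conv_lhs => rw [← Finset.insert_erase hz, Finset.filter_insert]
  split_ifs
  · rw [Finset.card_insert_of_notMem (by simp)]
  · rfl

/-- No non-empty set of sites is a forbidden subconfiguration. -/
def Burnable {d : ℕ} {Λ : Finset (Site d)} (η : Λ → ℝ) : Prop :=
  ∀ W : Finset Λ, W.Nonempty → ∃ x ∈ W, (degIn W x : ℝ) ≤ η x

lemma Burnable.toppling {d : ℕ} {γ : ℝ} {Λ : Finset (Site d)} {η η' : Λ → ℝ}
    (h : LegalToppling d γ Λ η η') (hη : Burnable η) : Burnable η' := by
  classical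
  obtain ⟨z, hz, rfl⟩ := h
  have hoff : ∀ x : Λ, x ≠ z → η x - topplingMatrix d γ Λ z x =
      η x + ((if len (x.1 - z.1) = 1 then 1 else 0 : ℕ) : ℝ) := by
    intro x hx
    rw [topplingMatrix, if_neg hx.symm, len_sub_comm]
    split_ifs <;> simp
  intro W hW
  by_cases hzW : z ∈ W
  · rcases (W.erase z).eq_empty_or_nonempty with h0 | h0
    · refine ⟨z, hzW, ?_⟩
      rw [degIn_eq_erase z hzW, h0]
      simp only [topplingMatrix, if_true]
      have : len (0 : Site d) ≠ 1 := by simp [len]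
      simp only [degIn, Finset.filter_empty, Finset.card_empty, sub_self, if_neg this]
      push_cast
      linarith
    · obtain ⟨x, hx, hle⟩ := hη _ h0
      refine ⟨x, Finset.mem_of_mem_erase hx, ?_⟩
      change (degIn W x : ℝ) ≤ η x - topplingMatrix d γ Λ z x
      rw [hoff x (Finset.ne_of_mem_erase hx), degIn_eq_erase x hzW, Nat.cast_add]
      linarith
  · obtain ⟨x, hx, hle⟩ := hη W hW
    refine ⟨x, hx, hle.trans ?_⟩
    change η x ≤ η x - topplingMatrix d γ Λ z x
    rw [hoff x (fun h => hzW (h ▸ hx))]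
    exact le_add_of_nonneg_right (Nat.cast_nonneg _)

lemma sum_topplingMatrix {d : ℕ} (γ : ℝ) {Λ : Finset (Site d)} {W : Finset Λ} {x : Λ}
    (hx : x ∈ W) : ∑ z ∈ W, topplingMatrix d γ Λ z x = 2 * d + γ - degIn W x := by
  classical
  have h1 : len (x.1 - x.1) ≠ 1 := by simp [len]
  rw [← Finset.add_sum_erase W _ hx, degIn_eq_erase x hx, if_neg h1, add_zero]
  have h2 : ∀ z ∈ W.erase x, topplingMatrix d γ Λ z x =
      -if len (x.1 - z.1) = 1 then (1 : ℝ) else 0 := by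
    intro z hz
    rw [topplingMatrix, if_neg (Finset.ne_of_mem_erase hz), len_sub_comm]
    split_ifs <;> simp
  rw [Finset.sum_congr rfl h2, Finset.sum_neg_distrib, Finset.sum_boole, degIn, topplingMatrix,
    if_pos rfl, sub_eq_add_neg]

/-- Each site of `W` topples exactly once, in the order in which the fire burns `W`. -/
lemma burn {d : ℕ} {γ : ℝ} {Λ : Finset (Site d)} {η : Λ → ℝ} (hη : Burnable η) (W : Finset Λ) :
    Relation.ReflTransGen (LegalToppling d γ Λ)
      (fun y => η y + ∑ z ∈ W, topplingMatrix d γ Λ z y) η := by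
  classical
  induction hn : W.card generalizing W with
  | zero =>
    rw [Finset.card_eq_zero.1 hn]
    simp [Relation.ReflTransGen.refl]
  | succ n ih =>
    obtain ⟨x, hx, hle⟩ := hη W (Finset.card_pos.1 (by omega))
    refine Relation.ReflTransGen.head ⟨x, ?_, ?_⟩
      (ih (W.erase x) (by rw [Finset.card_erase_of_mem hx, hn]; rfl))
    · change 2 * d + γ ≤ η x + ∑ z ∈ W, topplingMatrix d γ Λ z x
      rw [sum_topplingMatrix γ hx]
      linarith
    · funext y
      change _ = η y + ∑ z ∈ W, topplingMatrix d γ Λ z y - topplingMatrix d γ Λ x y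
      rw [← Finset.add_sum_erase W _ hx]
      ring

lemma LegalToppling.add {d : ℕ} {γ : ℝ} {Λ : Finset (Site d)} {η η' g : Λ → ℝ} (hg : 0 ≤ g)
    (h : LegalToppling d γ Λ η η') : LegalToppling d γ Λ (η + g) (η' + g) := by
  obtain ⟨x, hx, rfl⟩ := h
  refine ⟨x, hx.trans (le_add_of_nonneg_right (hg x)), ?_⟩
  funext y
  simp only [Pi.add_apply]
  ring

/-- Recurrence is the absence of forbidden subconfigurations: the latter is preserved by
topplings and holds for large heights, and conversely the burning algorithm reproduces `η` from
arbitrarily large heights. -/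
theorem mem_recurrentConfigs_iff {d : ℕ} {γ : ℝ} (hγ : 0 < γ) {Λ : Finset (Site d)} {η : Λ → ℝ} :
    η ∈ recurrentConfigs d γ Λ ↔ η ∈ stableConfigs d γ Λ ∧ Burnable η := by
  refine and_congr_right fun hst => ⟨fun h => ?_, fun hη ζ hζ => ?_⟩
  · obtain ⟨g, hg, hreach⟩ := h (fun _ => 2 * d) fun _ => by positivity
    have h0 : Burnable ((fun _ => 2 * d : Λ → ℝ) + g) := by
      rintro W ⟨x, hx⟩
      refine ⟨x, hx, ?_⟩
      have h1 : (degIn W x : ℝ) ≤ 2 * d := by exact_mod_cast degIn_le W x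
      exact h1.trans (le_add_of_nonneg_right (hg x))
    clear h hst
    induction hreach with
    | refl => exact h0
    | tail _ hstep ih => exact ih.toppling hstep
  · set β : Λ → ℝ := fun y => ∑ z, topplingMatrix d γ Λ z y with hβ
    have hβγ : ∀ y, γ ≤ β y := fun y => by
      have h1 : (degIn Finset.univ y : ℝ) ≤ 2 * d := by exact_mod_cast degIn_le Finset.univ y
      simp only [hβ]
      rw [sum_topplingMatrix γ (Finset.mem_univ y)]
      linarith
    have hβ0 : 0 ≤ β := fun y => hγ.le.trans (hβγ y)
    have hstep : ∀ k : ℕ, Relation.ReflTransGen (LegalToppling d γ Λ) (η + (k : ℝ) • β) η := by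
      intro k
      induction k with
      | zero => simp [Relation.ReflTransGen.refl]
      | succ k ih =>
        refine Relation.ReflTransGen.trans ?_ ih
        have h1 := Relation.ReflTransGen.lift (fun η => η + (k : ℝ) • β)
          (fun _ _ h => LegalToppling.add (smul_nonneg (Nat.cast_nonneg k) hβ0) h)
          _ _ (burn (γ := γ) hη Finset.univ)
        convert h1 using 1
        funext y
        simp only [Pi.add_apply, Pi.smul_apply, smul_eq_mul, Nat.cast_add, Nat.cast_one, hβ]
        ring
    obtain ⟨k, hk⟩ := exists_nat_ge ((∑ x, ζ x) / γ)
    refine ⟨η + (k : ℝ) • β - ζ, fun x => ?_, by rw [add_sub_cancel]; exact hstep k⟩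
    rw [div_le_iff₀ hγ] at hk
    have h1 : ζ x ≤ ∑ x, ζ x := Finset.single_le_sum (fun y _ => hζ y) (Finset.mem_univ x)
    have h2 : (k : ℝ) * γ ≤ k * β x := mul_le_mul_of_nonneg_left (hβγ x) (Nat.cast_nonneg k)
    have h3 := (hst x).1
    simp only [Pi.zero_apply, Pi.sub_apply, Pi.add_apply, Pi.smul_apply, smul_eq_mul]
    linarith

/-! ### The burning bijection -/

/-- The discrete form of `Burnable`. -/
def BurnableHeights {d : ℕ} {Λ : Finset (Site d)} (ξ : Λ → Fin (2 * d + 1)) : Prop :=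
  ∀ W : Finset Λ, W.Nonempty → ∃ x ∈ W, degIn W x ≤ (ξ x : ℕ)

/-- `D` is the burning time of the heights `ξ`: a site of height below `2d` burns as soon as its
height reaches the number of its unburnt neighbours, and one of height `2d` burns at once. The
inequalities say that the height lies in the interval of the labelling. -/
def IsBurningTime {d : ℕ} {Λ : Finset (Site d)} (ξ : Λ → Fin (2 * d + 1)) (D : Site d → ℕ) : Prop :=
  (∀ x ∉ Λ, D x = 0) ∧ ∀ x : Λ, 0 < D x.1 ∧ (((ξ x : ℕ) = 2 * d ∧ D x.1 = 1) ∨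
    ((ξ x : ℕ) < 2 * d ∧ 2 * d ≤ (ξ x : ℕ) + (closerDirs (D x.1) fun e => D (x.1 + e.1)).ncard ∧
      (ξ x : ℕ) + (closerDirs (D x.1) fun e => D (x.1 + e.1)).ncard <
        2 * d + (parentDirs (D x.1) fun e => D (x.1 + e.1)).ncard))

lemma ncard_setOf_dir {d : ℕ} (p : Dir d → Prop) [DecidablePred p] :
    {y : Site d | ∃ h : len y = 1, p ⟨y, h⟩}.ncard = (Finset.univ.filter p).card := by
  have : {y : Site d | ∃ h : len y = 1, p ⟨y, h⟩} =
      Subtype.val '' ((Finset.univ.filter p : Finset (Dir d)) : Set (Dir d)) := by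
    ext y
    constructor
    · rintro ⟨h, hp⟩
      exact ⟨⟨y, h⟩, by simpa using hp, rfl⟩
    · rintro ⟨e, he, rfl⟩
      exact ⟨e.2, by simpa using he⟩
  rw [this, Set.ncard_image_of_injective _ Subtype.val_injective, Set.ncard_coe_finset]

lemma ncard_closerDirs {d : ℕ} (k : ℕ) (D : Dir d → ℕ) :
    (closerDirs k D).ncard = (Finset.univ.filter fun e => D e < k).card :=
  ncard_setOf_dir fun e => D e < k

lemma ncard_parentDirs {d : ℕ} (k : ℕ) (D : Dir d → ℕ) :
    (parentDirs k D).ncard = (Finset.univ.filter fun e => D e + 1 = k).card :=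
  ncard_setOf_dir fun e => D e + 1 = k

lemma ncard_closerDirs_le {d : ℕ} (k : ℕ) (D : Dir d → ℕ) : (closerDirs k D).ncard ≤ 2 * d := by
  rw [ncard_closerDirs, ← card_dir d]
  exact Finset.card_le_univ _

lemma ncard_closerDirs_eq {d : ℕ} (k : ℕ) (D : Dir d → ℕ) : (closerDirs k D).ncard =
    (parentDirs k D).ncard + (Finset.univ.filter fun e => D e + 1 < k).card := by
  rw [ncard_closerDirs, ncard_parentDirs, ← Finset.card_union_of_disjoint]
  · congr 1
    ext e
    simp only [Finset.mem_filter, Finset.mem_univ, true_and, Finset.mem_union]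
    omega
  · rw [Finset.disjoint_filter]
    intro e _ h
    omega

/-- The labels of the parent directions fill the interval `[2d - n, 2d - n + |P|)` bijectively. -/
lemma IsLabelling.bijOn {d : ℕ} {α : Set (Site d) → Set ℕ → Site d → ℕ} (hα : IsLabelling d α)
    {k : ℕ} {D : Dir d → ℕ} (hne : (parentDirs k D).Nonempty) :
    Set.BijOn (α (parentDirs k D) (Set.Ico (2 * d - (closerDirs k D).ncard)
      (2 * d - (closerDirs k D).ncard + (parentDirs k D).ncard))) (parentDirs k D)
      (Set.Ico (2 * d - (closerDirs k D).ncard)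
        (2 * d - (closerDirs k D).ncard + (parentDirs k D).ncard)) := by
  refine hα _ _ hne (fun y hy => hy.1) ?_
  have h1 := ncard_closerDirs_le k D
  have h2 := ncard_closerDirs_eq k D
  omega

lemma localHeight_some {d : ℕ} {α : Set (Site d) → Set ℕ → Site d → ℕ} (hα : IsLabelling d α)
    {k : ℕ} {D : Dir d → ℕ} {e : Dir d} (he : D e + 1 = k) :
    (localHeight α (some e) k D : ℕ) = α (parentDirs k D)
      (Set.Ico (2 * d - (closerDirs k D).ncard)
        (2 * d - (closerDirs k D).ncard + (parentDirs k D).ncard)) e.1 ∧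
    2 * d ≤ (localHeight α (some e) k D : ℕ) + (closerDirs k D).ncard ∧
    (localHeight α (some e) k D : ℕ) + (closerDirs k D).ncard < 2 * d + (parentDirs k D).ncard ∧
    (localHeight α (some e) k D : ℕ) < 2 * d := by
  have hmem : e.1 ∈ parentDirs k D := ⟨e.2, he⟩
  have h := (hα.bijOn ⟨_, hmem⟩).mapsTo hmem
  have h1 := ncard_closerDirs_le k D
  have h2 := ncard_closerDirs_eq k D
  rw [Set.mem_Ico] at h
  simp only [localHeight]
  omega

lemma exists_localHeight_eq {d : ℕ} {α : Set (Site d) → Set ℕ → Site d → ℕ} (hα : IsLabelling d α)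
    {k : ℕ} {D : Dir d → ℕ} {m : Fin (2 * d + 1)}
    (h1 : 2 * d ≤ (m : ℕ) + (closerDirs k D).ncard)
    (h2 : (m : ℕ) + (closerDirs k D).ncard < 2 * d + (parentDirs k D).ncard) :
    ∃ e : Dir d, D e + 1 = k ∧ localHeight α (some e) k D = m := by
  have hne : (parentDirs k D).Nonempty := by
    refine Set.nonempty_of_ncard_ne_zero ?_
    omega
  have h3 := ncard_closerDirs_le k D
  obtain ⟨y, ⟨hy, he⟩, hval⟩ := (hα.bijOn hne).surjOn
    (show (m : ℕ) ∈ _ from Set.mem_Ico.2 ⟨by omega, by omega⟩)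
  exact ⟨⟨y, hy⟩, he, Fin.ext ((localHeight_some hα he).1.trans hval)⟩

lemma localHeight_injective {d : ℕ} {α : Set (Site d) → Set ℕ → Site d → ℕ}
    (hα : IsLabelling d α) {k : ℕ} {D : Dir d → ℕ} {c c' : Arrow d}
    (hc : ∀ e, c = some e → D e + 1 = k) (hc' : ∀ e, c' = some e → D e + 1 = k)
    (h : localHeight α c k D = localHeight α c' k D) : c = c' := by
  have hlast : ∀ e, D e + 1 = k → localHeight α none k D ≠ localHeight α (some e) k D := by
    intro e he h
    have h1 := (localHeight_some hα he).2.2.2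
    rw [← h] at h1
    simp [localHeight] at h1
  rcases c with _ | e <;> rcases c' with _ | e'
  · rfl
  · exact (hlast e' (hc' e' rfl) h).elim
  · exact (hlast e (hc e rfl) h.symm).elim
  · have he := hc e rfl
    have he' := hc' e' rfl
    have hmem : e.1 ∈ parentDirs k D := ⟨e.2, he⟩
    have hmem' : e'.1 ∈ parentDirs k D := ⟨e'.2, he'⟩
    have h1 := (localHeight_some hα he).1
    rw [h, (localHeight_some hα he').1] at h1
    rw [Subtype.ext ((hα.bijOn ⟨_, hmem⟩).injOn hmem' hmem h1)]

/-- The depth of the sites of the lattice in a field on `Λ`, with value zero off `Λ`. -/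
def siteDepth {d : ℕ} {Λ : Finset (Site d)} (b : Λ → Arrow d) (z : Site d) : ℕ :=
  depth (nextIn Λ b) (collapse Λ (some z))

lemma siteDepth_of_arrow {d : ℕ} {Λ : Finset (Site d)} {b : Λ → Arrow d}
    (hb : Rooted (nextIn Λ b)) {x : Λ} {e : Dir d} (h : b x = some e) :
    siteDepth b (x.1 + e.1) + 1 = siteDepth b x.1 := by
  rw [siteDepth, siteDepth, collapse_some, depth_some hb, nextIn, h]
  rfl

lemma heightsOn_eq {d : ℕ} (α : Set (Site d) → Set ℕ → Site d → ℕ) {Λ : Finset (Site d)}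
    (b : Λ → Arrow d) (x : Λ) : heightsOn α Λ b x =
      localHeight α (b x) (siteDepth b x.1) fun e => siteDepth b (x.1 + e.1) := by
  rw [heightsOn, siteDepth, collapse_some]
  rfl

lemma isBurningTime_siteDepth {d : ℕ} {α : Set (Site d) → Set ℕ → Site d → ℕ}
    (hα : IsLabelling d α) {Λ : Finset (Site d)} {b : Λ → Arrow d} (hb : Rooted (nextIn Λ b)) :
    IsBurningTime (heightsOn α Λ b) (siteDepth b) := by
  refine ⟨fun x hx => by simp [siteDepth, collapse, hx], fun x => ?_⟩
  rw [heightsOn_eq]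
  rcases hbx : b x with _ | e
  · have h1 : siteDepth b x.1 = 1 := by
      rw [siteDepth, collapse_some, depth_some hb, nextIn, hbx]
      simp [target, collapse]
    exact ⟨by omega, Or.inl ⟨by simp [localHeight], h1⟩⟩
  · have h1 := siteDepth_of_arrow hb hbx
    have h2 := localHeight_some hα (D := fun e => siteDepth b (x.1 + e.1)) h1
    exact ⟨by omega, Or.inr ⟨h2.2.2.2, h2.2.1, h2.2.2.1⟩⟩

lemma IsBurningTime.le_succ {d : ℕ} {Λ : Finset (Site d)} {ξ : Λ → Fin (2 * d + 1)}
    {D D' : Site d → ℕ} (hD : IsBurningTime ξ D) (hD' : IsBurningTime ξ D') {k : ℕ}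
    (ih : ∀ z, D z ≤ k ↔ D' z ≤ k) {z : Site d} (hz : D z ≤ k + 1) : D' z ≤ k + 1 := by
  rcases hz.lt_or_eq with h | hk
  · exact ((ih z).1 (by omega)).trans (by omega)
  by_cases hzΛ : z ∈ Λ
  · by_contra! hlt
    obtain ⟨-, ⟨h1, -⟩ | ⟨h1, h2, -⟩⟩ := hD.2 ⟨z, hzΛ⟩
    · rcases (hD'.2 ⟨z, hzΛ⟩).2 with ⟨-, h3⟩ | ⟨h3, -⟩
      · simp only at h3
        omega
      · omega
    · rcases (hD'.2 ⟨z, hzΛ⟩).2 with ⟨h3, -⟩ | ⟨-, -, h4⟩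
      · omega
      · rw [ncard_closerDirs_eq] at h4
        simp only [hk, ncard_closerDirs] at h2
        have h5 : (Finset.univ.filter fun e : Dir d => D (z + e.1) < k + 1).card ≤
            (Finset.univ.filter fun e : Dir d => D' (z + e.1) + 1 < D' z).card := by
          refine Finset.card_le_card fun e he => ?_
          simp only [Finset.mem_filter, Finset.mem_univ, true_and] at he ⊢
          have := (ih (z + e.1)).1 (by omega)
          omega
        simp only at h4
        omega
  · rw [hD'.1 z hzΛ]
    omega

lemma IsBurningTime.unique {d : ℕ} {Λ : Finset (Site d)} {ξ : Λ → Fin (2 * d + 1)}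
    {D D' : Site d → ℕ} (hD : IsBurningTime ξ D) (hD' : IsBurningTime ξ D') : D = D' := by
  have key : ∀ k z, D z ≤ k ↔ D' z ≤ k := by
    intro k
    induction k with
    | zero =>
      intro z
      by_cases hz : z ∈ Λ
      · have h1 := (hD.2 ⟨z, hz⟩).1
        have h2 := (hD'.2 ⟨z, hz⟩).1
        simp only at h1 h2
        omega
      · rw [hD.1 z hz, hD'.1 z hz]
    | succ k ih =>
      exact fun z => ⟨fun h => hD.le_succ hD' ih h,
        fun h => hD'.le_succ hD (fun z => (ih z).symm) h⟩
  exact funext fun z => le_antisymm ((key _ z).2 le_rfl) ((key _ z).1 le_rfl)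

/-- The site of `W` that burns first shows that `W` is not forbidden. -/
lemma IsBurningTime.burnableHeights {d : ℕ} {Λ : Finset (Site d)} {ξ : Λ → Fin (2 * d + 1)}
    {D : Site d → ℕ} (hD : IsBurningTime ξ D) : BurnableHeights ξ := by
  classical
  intro W hW
  obtain ⟨x, hx, hmin⟩ := W.exists_min_image (fun x => D x.1) hW
  refine ⟨x, hx, ?_⟩
  rcases (hD.2 x).2 with ⟨h1, -⟩ | ⟨-, h2, -⟩
  · rw [h1]
    exact degIn_le W x
  · rw [ncard_closerDirs] at h2
    have h3 : (Finset.univ.filter fun e : Dir d => D (x.1 + e.1) < D x.1).card + degIn W x ≤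
        2 * d := by
      rw [degIn_eq_card_dir, ← Finset.card_union_of_disjoint, ← card_dir d]
      · exact Finset.card_le_univ _
      · rw [Finset.disjoint_filter]
        rintro e - he ⟨z, hz, hze⟩
        have := hmin z hz
        rw [hze] at this
        omega
    omega

/-- The sites that are still unburnt after `k` rounds. -/
def unburnt {d : ℕ} {Λ : Finset (Site d)} (ξ : Λ → Fin (2 * d + 1)) : ℕ → Finset Λ
  | 0 => Finset.univ
  | k + 1 => (unburnt ξ k).filter fun x => (ξ x : ℕ) < degIn (unburnt ξ k) x

lemma unburnt_antitone {d : ℕ} {Λ : Finset (Site d)} (ξ : Λ → Fin (2 * d + 1)) :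
    Antitone (unburnt ξ) := antitone_nat_of_succ_le fun _ => Finset.filter_subset _ _

lemma BurnableHeights.exists_unburnt_eq_empty {d : ℕ} {Λ : Finset (Site d)}
    {ξ : Λ → Fin (2 * d + 1)} (hξ : BurnableHeights ξ) : ∃ k, unburnt ξ k = ∅ := by
  have key : ∀ k, unburnt ξ k = ∅ ∨ (unburnt ξ k).card + k ≤ Fintype.card Λ := by
    intro k
    induction k with
    | zero => right; exact Finset.card_le_univ _
    | succ k ih =>
      rcases ih with ih | ih
      · left
        exact Finset.subset_empty.1 (ih ▸ unburnt_antitone ξ k.le_succ)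
      · rcases (unburnt ξ k).eq_empty_or_nonempty with h0 | h0
        · left
          exact Finset.subset_empty.1 (h0 ▸ unburnt_antitone ξ k.le_succ)
        · right
          obtain ⟨x, hx, hle⟩ := hξ _ h0
          have : (unburnt ξ (k + 1)).card < (unburnt ξ k).card := by
            refine Finset.card_lt_card ⟨unburnt_antitone ξ k.le_succ, fun h => ?_⟩
            have := (Finset.mem_filter.1 (h hx)).2
            omega
          omega
  refine ⟨Fintype.card Λ + 1, (key _).resolve_right ?_⟩
  omega

lemma BurnableHeights.exists_isBurningTime {d : ℕ} {Λ : Finset (Site d)}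
    {ξ : Λ → Fin (2 * d + 1)} (hξ : BurnableHeights ξ) : ∃ D, IsBurningTime ξ D := by
  classical
  obtain ⟨K, hK⟩ := hξ.exists_unburnt_eq_empty
  have hex : ∀ x : Λ, ∃ k, x ∉ unburnt ξ k := fun x => ⟨K, by simp [hK]⟩
  set D : Site d → ℕ := fun z => if h : z ∈ Λ then Nat.find (hex ⟨z, h⟩) else 0 with hDdef
  have hDΛ : ∀ x : Λ, D x.1 = Nat.find (hex x) := fun x => dif_pos x.2
  have hmem : ∀ (x : Λ) k, x ∈ unburnt ξ k ↔ k < D x.1 := by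
    intro x k
    rw [hDΛ, Nat.lt_find_iff]
    exact ⟨fun h m hm => not_not.2 (unburnt_antitone ξ hm h), fun h => not_not.1 (h k le_rfl)⟩
  have hdeg : ∀ (x : Λ) k, degIn (unburnt ξ k) x +
      (Finset.univ.filter fun e : Dir d => D (x.1 + e.1) ≤ k).card = 2 * d := by
    intro x k
    rw [degIn_eq_card_dir, ← card_dir d, ← Finset.card_univ,
      ← Finset.card_filter_add_card_filter_not (s := (Finset.univ : Finset (Dir d)))
        (fun e : Dir d => ∃ z ∈ unburnt ξ k, z.1 = x.1 + e.1)]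
    congr 2
    ext e
    simp only [Finset.mem_filter, Finset.mem_univ, true_and]
    constructor
    · rintro h ⟨z, hz, hze⟩
      rw [hmem, hze] at hz
      omega
    · intro h
      by_contra! hlt
      by_cases hΛ : x.1 + e.1 ∈ Λ
      · exact h ⟨⟨_, hΛ⟩, (hmem _ _).2 hlt, rfl⟩
      · simp [hDdef, hΛ] at hlt
  refine ⟨D, fun x hx => dif_neg hx, fun x => ?_⟩
  have hpos : 0 < D x.1 := (hmem x 0).1 (Finset.mem_univ x)
  obtain ⟨j, hj⟩ : ∃ j, D x.1 = j + 1 := ⟨D x.1 - 1, by omega⟩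
  have hin : x ∈ unburnt ξ j := (hmem x j).2 (by omega)
  have hburn : degIn (unburnt ξ j) x ≤ ξ x := by
    by_contra! h
    have := (hmem x (j + 1)).1 (Finset.mem_filter.2 ⟨hin, h⟩)
    omega
  have hn : (closerDirs (D x.1) fun e => D (x.1 + e.1)).ncard =
      (Finset.univ.filter fun e : Dir d => D (x.1 + e.1) ≤ j).card := by
    rw [ncard_closerDirs, hj]
    simp only [Nat.lt_succ_iff]
  have hnp := ncard_closerDirs_eq (D x.1) fun e => D (x.1 + e.1)
  have hdegj := hdeg x j
  have hξle : (ξ x : ℕ) ≤ 2 * d := by omega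
  refine ⟨hpos, ?_⟩
  rcases j with _ | i
  · rcases hξle.lt_or_eq with hlt | heq
    · refine Or.inr ⟨hlt, by omega, ?_⟩
      have h0 : (Finset.univ.filter fun e : Dir d => D (x.1 + e.1) + 1 < D x.1).card = 0 := by
        rw [Finset.card_eq_zero, Finset.filter_eq_empty_iff]
        intro e _
        omega
      omega
    · exact Or.inl ⟨heq, hj⟩
  · have hlt : (ξ x : ℕ) < degIn (unburnt ξ i) x := (Finset.mem_filter.1 hin).2
    have hdegi := hdeg x i
    have h1 : (Finset.univ.filter fun e : Dir d => D (x.1 + e.1) + 1 < D x.1).card =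
        (Finset.univ.filter fun e : Dir d => D (x.1 + e.1) ≤ i).card := by
      congr 1
      ext e
      simp only [Finset.mem_filter, Finset.mem_univ, true_and]
      omega
    exact Or.inr ⟨by omega, by omega, by omega⟩

lemma IsBurningTime.exists_field {d : ℕ} {α : Set (Site d) → Set ℕ → Site d → ℕ}
    (hα : IsLabelling d α) {Λ : Finset (Site d)} {ξ : Λ → Fin (2 * d + 1)} {D : Site d → ℕ}
    (hD : IsBurningTime ξ D) : ∃ b, Rooted (nextIn Λ b) ∧ heightsOn α Λ b = ξ := by
  have hex : ∀ x : Λ, ∃ c : Arrow d,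
      localHeight α c (D x.1) (fun e => D (x.1 + e.1)) = ξ x ∧
      (target x.1 c).elim 0 D + 1 = D x.1 := by
    intro x
    rcases (hD.2 x).2 with ⟨h1, h2⟩ | ⟨-, h2, h3⟩
    · exact ⟨none, Fin.ext h1.symm, h2.symm⟩
    · obtain ⟨e, he, hval⟩ := exists_localHeight_eq hα h2 h3
      exact ⟨some e, hval, he⟩
  choose b hbξ hbD using hex
  have helim : ∀ u, (collapse Λ u).elim 0 (fun z => D z.1) = u.elim 0 D := by
    rintro (_ | z)
    · rfl
    · by_cases hz : z ∈ Λ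
      · simp [collapse, hz]
      · simp [collapse, hz, hD.1 z hz]
  obtain ⟨hr, hdepth⟩ := rooted_of_depth (f := nextIn Λ b) (fun u => u.elim 0 fun z => D z.1) rfl
    fun x => by
      simp only [nextIn, helim, Option.elim_some]
      exact (hbD x).symm
  have hsite : siteDepth b = D := by
    funext z
    rw [siteDepth, hdepth]
    exact helim (some z)
  refine ⟨b, hr, funext fun x => ?_⟩
  rw [heightsOn_eq, hsite, hbξ]

lemma heightsOn_injective {d : ℕ} {α : Set (Site d) → Set ℕ → Site d → ℕ} (hα : IsLabelling d α)
    {Λ : Finset (Site d)} {b b' : Λ → Arrow d} (hb : Rooted (nextIn Λ b))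
    (hb' : Rooted (nextIn Λ b')) (h : heightsOn α Λ b = heightsOn α Λ b') : b = b' := by
  have hD : siteDepth b = siteDepth b' :=
    (isBurningTime_siteDepth hα hb).unique (h ▸ isBurningTime_siteDepth hα hb')
  funext x
  have hx := congrFun h x
  rw [heightsOn_eq, heightsOn_eq, ← hD] at hx
  exact localHeight_injective hα (fun e he => siteDepth_of_arrow hb he)
    (fun e he => by rw [hD]; exact siteDepth_of_arrow hb' he) hx

/-! ### The discretized sandpile measure -/

/-- The length of the interval of heights with discretization `k`. -/
def cellLength {d : ℕ} (γ : ℝ) (k : Fin (2 * d + 1)) : ℝ := if (k : ℕ) = 2 * d then γ else 1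

lemma le_discretize_iff {d : ℕ} {r : ℝ} (hr : 0 ≤ r) {k : ℕ} (hk : k ≤ 2 * d) :
    k ≤ (discretize d r : ℕ) ↔ (k : ℝ) ≤ r := by
  simp only [discretize, le_min_iff, hk, and_true]
  exact Nat.le_floor_iff hr

lemma volume_cell {d : ℕ} {γ : ℝ} (hγ : 0 < γ) (k : Fin (2 * d + 1)) :
    volume {r : ℝ | (0 ≤ r ∧ r < 2 * d + γ) ∧ discretize d r = k} =
      ENNReal.ofReal (cellLength γ k) := by
  have hk2 : (k : ℕ) ≤ 2 * d := by omega
  by_cases hk : (k : ℕ) = 2 * d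
  · have : {r : ℝ | (0 ≤ r ∧ r < 2 * d + γ) ∧ discretize d r = k} =
        Set.Ico (2 * d : ℝ) (2 * d + γ) := by
      ext r
      have hcast : ((2 * d : ℕ) : ℝ) = 2 * d := by push_cast; ring
      constructor
      · rintro ⟨⟨h0, h1⟩, h2⟩
        refine ⟨?_, h1⟩
        rw [← hcast, ← le_discretize_iff h0 le_rfl, h2, hk]
      · rintro ⟨h1, h2⟩
        have h0 : 0 ≤ r := le_trans (by positivity) h1
        refine ⟨⟨h0, h2⟩, Fin.ext ?_⟩
        rw [← hcast, ← le_discretize_iff h0 le_rfl] at h1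
        omega
    rw [this, Real.volume_Ico, cellLength, if_pos hk]
    congr 1
    ring
  · have : {r : ℝ | (0 ≤ r ∧ r < 2 * d + γ) ∧ discretize d r = k} =
        Set.Ico ((k : ℕ) : ℝ) ((k : ℕ) + 1) := by
      ext r
      have hk3 : (k : ℕ) + 1 ≤ 2 * d := by omega
      have hk4 : ((k : ℕ) : ℝ) + 1 ≤ 2 * d := by exact_mod_cast hk3
      have hiff : 0 ≤ r → (discretize d r = k ↔ r ∈ Set.Ico ((k : ℕ) : ℝ) ((k : ℕ) + 1)) := by
        intro h0
        have h1 := le_discretize_iff h0 hk2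
        have h2 := le_discretize_iff h0 hk3
        push_cast at h2
        rw [Set.mem_Ico, ← h1, ← not_le, ← h2, Fin.ext_iff]
        omega
      constructor
      · rintro ⟨⟨h0, -⟩, h2⟩
        exact (hiff h0).1 h2
      · intro h
        have h0 : 0 ≤ r := (Nat.cast_nonneg _).trans h.1
        exact ⟨⟨h0, by linarith [h.2]⟩, (hiff h0).2 h⟩
    rw [this, Real.volume_Ico, cellLength, if_neg hk]
    congr 1
    ring

lemma burnable_iff {d : ℕ} {γ : ℝ} {Λ : Finset (Site d)} {η : Λ → ℝ}
    (hη : η ∈ stableConfigs d γ Λ) :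
    Burnable η ↔ BurnableHeights fun x => discretize d (η x) := by
  refine forall₂_congr fun W _ => exists_congr fun x => and_congr_right fun _ => ?_
  rw [le_discretize_iff (hη x).1 (degIn_le W x)]

lemma measurable_discretize (d : ℕ) : Measurable (discretize d) := by
  have h : Measurable fun n : ℕ => (⟨min n (2 * d), by omega⟩ : Fin (2 * d + 1)) :=
    Measurable.of_discrete
  exact h.comp Nat.measurable_floor

lemma arrowWeight_eq_cellLength {d : ℕ} {α : Set (Site d) → Set ℕ → Site d → ℕ}
    (hα : IsLabelling d α) (γ : ℝ) {Λ : Finset (Site d)} {b : Λ → Arrow d}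
    (hb : Rooted (nextIn Λ b)) (x : Λ) :
    arrowWeight γ (b x) = cellLength γ (heightsOn α Λ b x) := by
  rw [heightsOn_eq]
  rcases hbx : b x with _ | e
  · simp [arrowWeight, cellLength, localHeight]
  · have h := (localHeight_some hα (D := fun e => siteDepth b (x.1 + e.1))
      (siteDepth_of_arrow hb hbx)).2.2.2
    rw [cellLength, if_neg h.ne]
    rfl

/-- The volume of the recurrent configurations with discretization `ξ` is the weight of the field
that corresponds to `ξ`. -/
theorem map_restrict_recurrentConfigs {d : ℕ} {γ : ℝ} (hγ : 0 < γ)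
    {α : Set (Site d) → Set ℕ → Site d → ℕ} (hα : IsLabelling d α) (Λ : Finset (Site d)) :
    (volume.restrict (recurrentConfigs d γ Λ)).map (fun η x => discretize d (η x)) =
      (fieldSum γ Λ).map (heightsOn α Λ) := by
  classical
  have hm : Measurable fun (η : Λ → ℝ) x => discretize d (η x) :=
    measurable_pi_iff.2 fun x => (measurable_discretize d).comp (measurable_pi_apply x)
  rw [fieldSum_map]
  refine Measure.ext_of_singleton fun ξ => ?_
  rw [Measure.map_apply hm (measurableSet_singleton ξ),
    Measure.restrict_apply (hm (measurableSet_singleton ξ)), Measure.coe_finsetSum,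
    Finset.sum_apply]
  simp only [Measure.smul_apply, Measure.dirac_apply, smul_eq_mul]
  by_cases hξ : BurnableHeights ξ
  · obtain ⟨D, hD⟩ := hξ.exists_isBurningTime
    obtain ⟨b, hb, rfl⟩ := hD.exists_field hα
    have hset : (fun (η : Λ → ℝ) x => discretize d (η x)) ⁻¹' {heightsOn α Λ b} ∩
        recurrentConfigs d γ Λ = Set.univ.pi fun x =>
          {r : ℝ | (0 ≤ r ∧ r < 2 * d + γ) ∧ discretize d r = heightsOn α Λ b x} := by
      ext η
      simp only [Set.mem_inter_iff, mem_recurrentConfigs_iff hγ, Set.mem_pi, Set.mem_univ,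
        true_imp_iff]
      constructor
      · rintro ⟨h1, h2, -⟩ x
        exact ⟨h2 x, congrFun h1 x⟩
      · intro h
        have h1 : (fun x => discretize d (η x)) = heightsOn α Λ b := funext fun x => (h x).2
        have h2 : η ∈ stableConfigs d γ Λ := fun x => (h x).1
        exact ⟨h1, h2, (burnable_iff h2).2 (h1 ▸ hξ)⟩
    rw [hset, volume_pi_pi, Finset.sum_eq_single b]
    · simp only [volume_cell hγ, Set.indicator_of_mem (Set.mem_singleton _), Pi.one_apply, mul_one]
      rw [fieldWeight, ENNReal.ofReal_prod_of_nonneg fun x _ => (arrowWeight_pos hγ _).le]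
      exact Finset.prod_congr rfl fun x _ => by rw [arrowWeight_eq_cellLength hα γ hb]
    · intro b' hb' hne
      rw [Set.indicator_of_notMem, mul_zero]
      exact fun h => hne (heightsOn_injective hα (mem_rootedFields.1 hb') hb h)
    · exact fun h => absurd (mem_rootedFields.2 hb) h
  · have hset : (fun (η : Λ → ℝ) x => discretize d (η x)) ⁻¹' {ξ} ∩ recurrentConfigs d γ Λ = ∅ := by
      rw [Set.eq_empty_iff_forall_notMem]
      rintro η ⟨rfl, h⟩
      rw [mem_recurrentConfigs_iff hγ] at h
      exact hξ ((burnable_iff h.1).1 h.2)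
    rw [hset, measure_empty]
    symm
    refine Finset.sum_eq_zero fun b hb => ?_
    rw [Set.indicator_of_notMem, mul_zero]
    rintro rfl
    exact hξ (isBurningTime_siteDepth hα (mem_rootedFields.1 hb)).burnableHeights

theorem nuMeasure_eq_map {d : ℕ} {γ : ℝ} (hγ : 0 < γ)
    {α : Set (Site d) → Set ℕ → Site d → ℕ} (hα : IsLabelling d α) (Λ : Finset (Site d)) :
    nuMeasure d γ Λ = (fieldMeasure γ Λ).map fun b => extendZero d Λ (heightsOn α Λ b) := by
  have hm : Measurable fun (η : Λ → ℝ) x => discretize d (η x) :=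
    measurable_pi_iff.2 fun x => (measurable_discretize d).comp (measurable_pi_apply x)
  have hh : Measurable (heightsOn α Λ) := Measurable.of_discrete
  have hz : Measurable (extendZero d Λ) := Measurable.of_discrete
  have hvol : volume (recurrentConfigs d γ Λ) = fieldSum γ Λ Set.univ := by
    have := congrArg (fun m => m Set.univ) (map_restrict_recurrentConfigs hγ hα Λ)
    simpa [Measure.map_apply hm .univ, Measure.map_apply hh .univ] using this
  rw [nuMeasure, mMeasure, ProbabilityTheory.cond, hvol, Measure.map_smul,
    map_restrict_recurrentConfigs hγ hα, fieldMeasure, ← Measure.map_smul, Measure.map_map hz hh]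
  rfl

/-! ### The infinite-volume limit -/

lemma exists_isLabelling (d : ℕ) : ∃ α, IsLabelling d α := by
  classical
  have h : ∀ (P : Set (Site d)) (K : Set ℕ), ∃ f : Site d → ℕ,
      P.Finite → K.Finite → P.ncard = K.ncard → Set.BijOn f P K := by
    intro P K
    by_cases hPK : P.Finite ∧ K.Finite ∧ P.ncard = K.ncard
    · obtain ⟨hP, hK, hcard⟩ := hPK
      have := hP.to_subtype
      have := hK.to_subtype
      let e : P ≃ K := (Finite.card_eq.1 hcard).some
      refine ⟨fun x => if h : x ∈ P then e ⟨x, h⟩ else 0, fun _ _ _ => ⟨?_, ?_, ?_⟩⟩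
      · intro x hx
        simp [hx]
      · intro x hx y hy hxy
        simp only [hx, hy, dif_pos] at hxy
        exact congrArg Subtype.val (e.injective (Subtype.ext hxy))
      · intro k hk
        exact ⟨(e.symm ⟨k, hk⟩).1, (e.symm ⟨k, hk⟩).2, by simp⟩
    · exact ⟨fun _ => 0, fun h1 h2 h3 => absurd ⟨h1, h2, h3⟩ hPK⟩
  choose α hα using h
  refine ⟨α, fun P k _ hP _ => hα _ _ ((setOf_len_finite d).subset hP) (Set.finite_Ico _ _) ?_⟩
  rw [← Finset.coe_Ico, Set.ncard_coe_finset, Nat.card_Ico, Nat.add_sub_cancel_left]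

lemma treeOf_injective {d : ℕ} {a a' : ArrowField d} (ha : Rooted (next a))
    (ha' : Rooted (next a')) (h : treeOf a = treeOf a') : a = a' := by
  have htree : (openGraph (treeOf a)).IsTree := by
    rw [openGraph_treeOf]
    exact parentGraph_isTree ha
  funext x
  have key : ∀ (ω : EdgeConfig d) (hω : (openGraph ω).IsTree), ω = treeOf a' →
      (rootPath ω hω x).snd = target x (a' x) := by
    rintro _ hω rfl
    exact rootPath_treeOf_snd ha' hω x
  exact target_injective x ((rootPath_treeOf_snd ha htree x).symm.trans (key _ htree h))

/-- By the Lusin-Souslin theorem the tree of a rooted field determines the field measurably. -/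
lemma measurableEmbedding_treeOf (d : ℕ) :
    MeasurableEmbedding fun a : {a : ArrowField d | Rooted (next a)} => treeOf a.1 := by
  have := (measurableSet_rooted d).standardBorel
  exact ((measurable_treeOf d).comp measurable_subtype_coe).measurableEmbedding
    fun a a' h => Subtype.ext (treeOf_injective a.2 a'.2 h)

end DissipativeSandpile

end

open DissipativeSandpile in
theorem mainTheorem7 (d : ℕ) (hd : 1 ≤ d) (γ : ℝ) (hγ : 0 < γ) :
    ∃ (μ : Measure (EdgeConfig d)) (ν : Measure (Heights d)),
      WeaklyConverges (atTop : Filter (Finset (Site d))) (muMeasure d γ) μ ∧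
      (∀ᵐ ω ∂μ, (openGraph ω).IsTree) ∧
      WeaklyConverges (atTop : Filter (Finset (Site d))) (nuMeasure d γ) ν ∧
      ∀ α : Set (Site d) → Set ℕ → Site d → ℕ, IsLabelling d α →
        AEMeasurable (phi d α) μ ∧ μ.map (phi d α) = ν := by
  obtain ⟨Q, hQ, hroot⟩ := exists_fieldLimit (d := d) hγ
  obtain ⟨α₀, hα₀⟩ := exists_isLabelling d
  have hν : ∀ α, IsLabelling d α →
      WeaklyConverges atTop (nuMeasure d γ) (Q.map (heights α)) := fun α hα => by
    rw [funext fun Λ => nuMeasure_eq_map hγ hα Λ]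
    exact weaklyConverges_heights hγ hQ hroot α
  -- the law of the tree, as an image of a measure that lives on rooted fields only
  set R : Measure {a : ArrowField d | Rooted (next a)} := Q.comap Subtype.val with hR
  have hRQ : R.map Subtype.val = Q := by
    rw [hR, map_comap_subtype_coe (measurableSet_rooted d)]
    exact Measure.restrict_eq_self_of_ae_mem hroot
  have hemb := measurableEmbedding_treeOf d
  have hμ : Q.map treeOf = R.map fun a => treeOf a.1 := by
    conv_lhs => rw [← hRQ]
    exact Measure.map_map (measurable_treeOf d) measurable_subtype_coe
  refine ⟨Q.map treeOf, Q.map (heights α₀), ?_, ?_, hν α₀ hα₀, fun α hα => ?_⟩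
  · rw [funext fun Λ => muMeasure_eq_map γ Λ]
    exact weaklyConverges_treeOn hγ hQ
  · rw [hμ, hemb.ae_map_iff]
    refine ae_of_all _ fun a => ?_
    rw [openGraph_treeOf]
    exact parentGraph_isTree a.2
  · have hcomp : (phi d α ∘ fun a : {a : ArrowField d | Rooted (next a)} => treeOf a.1) =
        heights α ∘ Subtype.val := funext fun a => phi_treeOf α a.2
    have hmeas : AEMeasurable (phi d α) (R.map fun a => treeOf a.1) := by
      rw [hemb.aemeasurable_map_iff, hcomp]
      exact ((measurable_heights α).comp measurable_subtype_coe).aemeasurable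
    refine ⟨hμ ▸ hmeas, ?_⟩
    rw [hμ, AEMeasurable.map_map_of_aemeasurable hmeas hemb.measurable.aemeasurable, hcomp,
      ← Measure.map_map (measurable_heights α) measurable_subtype_coe, hRQ]
    obtain ⟨_, h1, h2⟩ := hν α hα
    obtain ⟨_, h3, h4⟩ := hν α₀ hα₀
    exact congrArg (fun P : ProbabilityMeasure (Heights d) => (P : Measure (Heights d)))
      (tendsto_nhds_unique h2 h4)
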